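/- Let $n\in\{1,2,3\}$ and let $\sigma\in L^\infty(\mathbf R)$ be real-valued. Let $\zeta_1,\zeta_2$ be the solutions of $\zeta_j''(t)+\sigma(t)\zeta_j(t)=0$ (so $\zeta_j\in C^1(\mathbf R)$, $\zeta_j'$ is locally absolutely continuous and the equation holds for almost every $t$) with $\zeta_1(0)=1,\ \zeta_1'(0)=0$ and $\zeta_2(0)=0,\ \zeta_2'(0)=1$. Let $r_0>1$, and assume that there are a constant $c>0$ and real numbers $c_{1,\pm},c_{2,\pm}\neq 0$ such that $|\zeta_2(t)|\ge c$ for all $|t|>r_0$ and $$\lim_{t\to\pm\infty}\frac{\zeta_1(t)}{|t|^{1/2}}=c_{1,\pm},\qquad \lim_{t\to\pm\infty}\frac{\zeta_2(t)}{|t|^{1/2}\log|t|}=c_{2,\pm}.$$ Let $H_0(t)=-\tfrac12\Delta+\tfrac12\sigma(t)|x|^2$, and let $\{U_0(t,s)\}_{(t,s)\in\mathbf R^2}$ be a propagator for $H_0(t)$, that is, a family of unitary operators on $L^2(\mathbf R^n)$ with $U_0(t,\tau)U_0(\tau,s)=U_0(t,s)$, $U_0(s,s)=\mathrm{Id}$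 and $$i\partial_tU_0(t,s)=H_0(t)U_0(t,s),\qquad i\partial_sU_0(t,s)=-U_0(t,s)H_0(s),$$ where these equations are understood weakly on the Schwartz space $\mathscr S(\mathbf R^n)$ and integrated in time: for all $\phi,\psi\in\mathscr S(\mathbf R^n)$ and $s,t\in\mathbf R$ the integrands below are locally integrable in $\tau$ and $$i\langle\psi,U_0(t,s)\phi-\phi\rangle=\int_s^t\langle H_0(\tau)\psi,U_0(\tau,s)\phi\rangle\,d\tau,\qquad i\langle\psi,U_0(t,s)\phi-\phi\rangle=-\int_t^s\langle\psi,U_0(t,\tau)H_0(\tau)\phi\rangle\,d\tau .$$ Then there is a constant $C>0$, depending only on $n$, $\sigma$ and $r_0$, such that for every $t$ with $|t|>r_0$ the operator $U_0(t,0)$, restricted to $L^1(\mathbf R^n)\cap L^2(\mathbf R^n)$, extends to a bounded operator from $L^1(\mathbf R^n)$ to $L^\infty(\mathbf R^n)$, again denoted by $U_0(t,0)$, and $$\|U_0(t,0)\phi\|_\infty\le C\,|t|^{-n/4}(\log|t|)^{-n/2}\,\|\phi\|_1\qquad\text{for all }\phi\in L^1(\mathbf R^n).$$ -/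

import Mathlib

open MeasureTheory Filter Topology
open scoped SchwartzMap Laplacian ENNReal

noncomputable section

namespace CriticalHarmonic

/-- `ℝⁿ` with its Euclidean norm. -/
abbrev Space (n : ℕ) : Type := EuclideanSpace ℝ (Fin n)

/-- The complex Hilbert space `L²(ℝⁿ)`. -/
abbrev L2 (n : ℕ) : Type := Lp ℂ 2 (volume : Measure (Space n))

/-- `ζ` is the (Carathéodory) solution of `ζ'' + σ ζ = 0`, `ζ 0 = a`, `ζ' 0 = b`: it is `C¹` and
`ζ'` is the indefinite integral of `-σ ζ`. For `σ ∈ L^∞` this says that `ζ'` is locally absolutely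
continuous and that the equation holds for almost every `t`. -/
structure SolvesIVP (σ ζ : ℝ → ℝ) (a b : ℝ) : Prop where
  contDiff : ContDiff ℝ 1 ζ
  init : ζ 0 = a
  deriv_eq : ∀ t : ℝ, deriv ζ t = b - ∫ τ in (0 : ℝ)..t, σ τ * ζ τ

/-- The standing assumption on the coefficient `σ ∈ L^∞(ℝ)`, in terms of the fundamental solutions
`ζ₁`, `ζ₂` and the threshold time `r₀`. -/
structure CriticalAssumption (σ ζ₁ ζ₂ : ℝ → ℝ) (r₀ : ℝ) : Prop where
  memLp : MemLp σ ∞ (volume : Measure ℝ)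
  fund₁ : SolvesIVP σ ζ₁ 1 0
  fund₂ : SolvesIVP σ ζ₂ 0 1
  one_lt : 1 < r₀
  lower : ∃ c : ℝ, 0 < c ∧ ∀ t : ℝ, r₀ < |t| → c ≤ |ζ₂ t|
  lim₁_top : ∃ c : ℝ, c ≠ 0 ∧
    Tendsto (fun t : ℝ => ζ₁ t / |t| ^ (1 / 2 : ℝ)) atTop (𝓝 c)
  lim₁_bot : ∃ c : ℝ, c ≠ 0 ∧
    Tendsto (fun t : ℝ => ζ₁ t / |t| ^ (1 / 2 : ℝ)) atBot (𝓝 c)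
  lim₂_top : ∃ c : ℝ, c ≠ 0 ∧
    Tendsto (fun t : ℝ => ζ₂ t / (|t| ^ (1 / 2 : ℝ) * Real.log |t|)) atTop (𝓝 c)
  lim₂_bot : ∃ c : ℝ, c ≠ 0 ∧
    Tendsto (fun t : ℝ => ζ₂ t / (|t| ^ (1 / 2 : ℝ) * Real.log |t|)) atBot (𝓝 c)

/-- The Hamiltonian `H₀(t) = -Δ/2 + σ(t)|x|²/2` on the Schwartz space. -/
def hamiltonian {n : ℕ} (σ : ℝ → ℝ) (t : ℝ) (ψ : 𝓢(Space n, ℂ)) : 𝓢(Space n, ℂ) :=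
  -((1 / 2 : ℂ) • Δ ψ) +
    ((σ t / 2 : ℝ) : ℂ) • SchwartzMap.smulLeftCLM ℂ (fun x : Space n => ‖x‖ ^ 2) ψ

/-- The pointwise formula for `H₀(t)`. -/
theorem hamiltonian_apply {n : ℕ} (σ : ℝ → ℝ) (t : ℝ) (ψ : 𝓢(Space n, ℂ)) (x : Space n) :
    hamiltonian σ t ψ x =
      -(1 / 2 : ℂ) * Δ (ψ : Space n → ℂ) x + ((σ t * ‖x‖ ^ 2 / 2 : ℝ) : ℂ) * ψ x := by
  have h : (fun x : Space n => ‖x‖ ^ 2).HasTemperateGrowth := Function.hasTemperateGrowth_norm_sq _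
  simp only [hamiltonian, add_apply, neg_apply, smul_apply,
    SchwartzMap.smulLeftCLM_apply_apply h, SchwartzMap.laplacian_apply]
  simp
  ring

/-- The class in `L²(ℝⁿ)` of a Schwartz function. -/
def toL2 {n : ℕ} (ψ : 𝓢(Space n, ℂ)) : L2 n := ψ.toLp 2

/-- `U` is a propagator for `H₀(t) = -Δ/2 + σ(t)|x|²/2`: a family of unitary operators on `L²(ℝⁿ)`
with `U(t,τ) U(τ,s) = U(t,s)`, `U(s,s) = Id`, and
`i ∂ₜ U(t,s) = H₀(t) U(t,s)`, `i ∂ₛ U(t,s) = -U(t,s) H₀(s)`.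

As `σ` is only in `L^∞`, the two differential equations are required in integrated form (that is,
for almost every time, with locally absolutely continuous dependence on it); they are
tested on Schwartz functions, which lie in the domain of every `H₀(t)`, and `H₀(t)` is moved to the
test function by symmetry. The inner product is conjugate linear in its first argument. -/
structure IsPropagator {n : ℕ} (σ : ℝ → ℝ) (U : ℝ → ℝ → (L2 n ≃ₗᵢ[ℂ] L2 n)) : Prop where
  comp : ∀ (t τ s : ℝ) (φ : L2 n), U t τ (U τ s φ) = U t s φ
  refl : ∀ (s : ℝ) (φ : L2 n), U s s φ = φ
  forward_integrable : ∀ (s t : ℝ) (φ ψ : 𝓢(Space n, ℂ)),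
    IntervalIntegrable
      (fun τ : ℝ => inner ℂ (toL2 (hamiltonian σ τ ψ)) (U τ s (toL2 φ))) volume s t
  forward : ∀ (s t : ℝ) (φ ψ : 𝓢(Space n, ℂ)),
    Complex.I * (inner ℂ (toL2 ψ) (U t s (toL2 φ)) - inner ℂ (toL2 ψ) (toL2 φ)) =
      ∫ τ in s..t, inner ℂ (toL2 (hamiltonian σ τ ψ)) (U τ s (toL2 φ))
  backward_integrable : ∀ (t s : ℝ) (φ ψ : 𝓢(Space n, ℂ)),
    IntervalIntegrable
      (fun τ : ℝ => inner ℂ (toL2 ψ) (U t τ (toL2 (hamiltonian σ τ φ)))) volume t s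
  backward : ∀ (t s : ℝ) (φ ψ : 𝓢(Space n, ℂ)),
    Complex.I * (inner ℂ (toL2 ψ) (U t s (toL2 φ)) - inner ℂ (toL2 ψ) (toL2 φ)) =
      -∫ τ in t..s, inner ℂ (toL2 ψ) (U t τ (toL2 (hamiltonian σ τ φ)))

/-- `T` extends the operator `V` on `L²(ℝⁿ)` to a bounded operator from `L¹(ℝⁿ)` to `L^∞(ℝⁿ)`: the
two agree on `L¹ ∩ L²`. Since `L¹ ∩ L²` is dense in `L¹`, there is at most one such `T`. -/
def ExtendsToL1 {n : ℕ} (V : L2 n ≃ₗᵢ[ℂ] L2 n)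
    (T : Lp ℂ 1 (volume : Measure (Space n)) →L[ℂ] Lp ℂ ∞ (volume : Measure (Space n))) : Prop :=
  ∀ (f : Lp ℂ 1 (volume : Measure (Space n))) (g : L2 n),
    (f : Space n → ℂ) =ᵐ[volume] (g : Space n → ℂ) →
      (T f : Space n → ℂ) =ᵐ[volume] (V g : Space n → ℂ)

end CriticalHarmonic

end

/-!
The adjoint of `U(t,0)` is computed on Gaussians, which determines its dispersive behaviour without
any formula for the kernel of `U(t,0)`.

A Gaussian `exp (c + b ⟨x, y⟩ - a ‖y‖² / 2)` whose parameters satisfy `a' = i (σ - a²)`,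
`b' = -i a b`, `c' = (i / 2) (b² ‖x‖² - n a)` solves `i ∂ₜ v = H₀(t) v` classically, so that
`⟨v(τ), U(τ,0) φ⟩` is constant in `τ` (`IsPropagator.hasDerivAt_inner_gaussian`). Since `σ` is only
bounded, neither factor need be differentiable at a given time; but their increments are controlled
by the increments of `∫ σ`, and these contributions cancel up to `o(h)` at every time
(`hasDerivAt_integral_smul_sub`). The derivative therefore vanishes everywhere, and no almost
everywhere argument is needed. The same device gives the constancy of Wronskians, through the
quasi-derivative `ζ' + (∫ σ) ζ`.

The Riccati equation for `a` is linearised by `a = -i w' / w` with `w = ε u + i v`, where `u`, `v`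
are the solutions with Cauchy data `(1, 0)`, `(0, 1)` at time `T`; then `b = 1 / w`, and `c` is
explicit up to a logarithm of `w`. At time `T` this is the Gaussian of variance `ε` centred
at `x`, with mass independent of `ε`, while at time `0` its modulus is at most
`|w(0)|^{-n/2} ≤ |v(0)|^{-n/2} = |ζ₂(T)|^{-n/2}` (`IsPropagator.exists_inner_gaussian_eq`). Hence
for `φ ∈ L¹ ∩ L²` all Gaussian means of `U(T,0) φ` are at most `|ζ₂(T)|^{-n/2} ‖φ‖₁`, and so, up to
a constant, is `U(T,0) φ` almost everywhere (`ae_norm_le_of_norm_integral_weight_le`). The operator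
extends to `L¹` by density (`exists_extendsToL1`), and the assumptions on `ζ₂` give
`|ζ₂(t)| ≥ κ |t|^{1/2} log |t|` for `|t| > r₀`.
-/

noncomputable section

namespace CriticalHarmonic

/-! ### Complex Gaussians as Schwartz functions -/

section Gaussian

variable {n : ℕ}

/-- The quadratic polynomial `c + b ⟨x, y⟩ - a ‖y‖² / 2` in `y`, with complex coefficients. -/
def quadPhase (x : Space n) (a b c : ℂ) (y : Space n) : ℂ :=
  c + b * ((inner ℝ x y : ℝ) : ℂ) - a / 2 * ((‖y‖ ^ 2 : ℝ) : ℂ)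

lemma hasTemperateGrowth_quadPhase (x : Space n) (a b c : ℂ) :
    (quadPhase x a b c).HasTemperateGrowth := by
  unfold quadPhase
  fun_prop

lemma re_quadPhase (x : Space n) (a b c : ℂ) (y : Space n) :
    (quadPhase x a b c y).re = c.re + b.re * inner ℝ x y - a.re / 2 * ‖y‖ ^ 2 := by
  have h : a / 2 = ((1 / 2 : ℝ) : ℂ) * a := by push_cast; ring
  simp only [quadPhase, Complex.sub_re, Complex.add_re, Complex.re_mul_ofReal, h,
    Complex.re_ofReal_mul]
  ring

lemma norm_iteratedFDeriv_cexp_le (k : ℕ) (z : ℂ) :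
    ‖iteratedFDeriv ℝ k Complex.exp z‖ ≤ ‖Complex.exp z‖ := by
  induction k with
  | zero => simp
  | succ k ih =>
    have h : fderiv ℝ Complex.exp = ContinuousLinearMap.mul ℝ ℂ ∘ Complex.exp := by
      ext1 z
      have := ((Complex.hasStrictDerivAt_exp z).hasDerivAt.hasFDerivAt.restrictScalars ℝ).fderiv
      rw [this]
      ext
      simp [mul_comm]
    rw [← norm_iteratedFDeriv_fderiv, h]
    refine ((ContinuousLinearMap.mul ℝ ℂ).norm_iteratedFDeriv_comp_left
      (Complex.contDiff_exp.contDiffAt (n := (k : WithTop ℕ∞))) (by simp)).trans ?_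
    exact (mul_le_of_le_one_left (norm_nonneg _) (ContinuousLinearMap.opNorm_mul_le ℝ ℂ)).trans ih

/-- A Gaussian decays faster than any power. -/
lemma exists_pow_mul_norm_cexp_quadPhase_le (x : Space n) {a : ℂ} (b c : ℂ) (ha : 0 < a.re)
    (k : ℕ) : ∃ C : ℝ, 0 ≤ C ∧
      ∀ y : Space n, (1 + ‖y‖) ^ k * ‖Complex.exp (quadPhase x a b c y)‖ ≤ C := by
  set B := ‖b‖ * ‖x‖ with hB
  refine ⟨k.factorial * Real.exp (1 + c.re + (B + 1) ^ 2 / (2 * a.re)), by positivity, fun y ↦ ?_⟩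
  have h1 : (1 + ‖y‖) ^ k ≤ k.factorial * Real.exp (1 + ‖y‖) := by
    have := Real.pow_div_factorial_le_exp (x := 1 + ‖y‖) (by positivity) k
    rwa [div_le_iff₀' (by positivity)] at this
  have h2 : b.re * inner ℝ x y ≤ B * ‖y‖ := by
    calc b.re * inner ℝ x y ≤ |b.re| * |inner ℝ x y| := by rw [← abs_mul]; exact le_abs_self _
      _ ≤ ‖b‖ * (‖x‖ * ‖y‖) := by
        gcongr
        · exact Complex.abs_re_le_norm b
        · exact abs_real_inner_le_norm x y
      _ = B * ‖y‖ := by rw [hB]; ring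
  rw [Complex.norm_exp, re_quadPhase]
  calc _ ≤ k.factorial * Real.exp (1 + ‖y‖) *
        Real.exp (c.re + b.re * inner ℝ x y - a.re / 2 * ‖y‖ ^ 2) := by gcongr
    _ = k.factorial *
        Real.exp (1 + ‖y‖ + (c.re + b.re * inner ℝ x y - a.re / 2 * ‖y‖ ^ 2)) := by
      rw [mul_assoc, ← Real.exp_add]
    _ ≤ _ := by
      refine mul_le_mul_of_nonneg_left (Real.exp_le_exp.2 ?_) (by positivity)
      -- completing the square in `‖y‖`
      have h3 : (B + 1) ^ 2 / (2 * a.re) - (B + 1) * ‖y‖ + a.re / 2 * ‖y‖ ^ 2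
          = (B + 1 - a.re * ‖y‖) ^ 2 / (2 * a.re) := by field_simp; ring
      have h4 : 0 ≤ (B + 1 - a.re * ‖y‖) ^ 2 / (2 * a.re) := by positivity
      linarith

/-- The Gaussian `y ↦ exp (c + b ⟨x, y⟩ - a ‖y‖² / 2)`, `Re a > 0`, as a Schwartz function. -/
def gaussian (x : Space n) (a b c : ℂ) (ha : 0 < a.re) : 𝓢(Space n, ℂ) where
  toFun y := Complex.exp (quadPhase x a b c y)
  smooth' := Complex.contDiff_exp.comp (hasTemperateGrowth_quadPhase x a b c).1
  decay' := by
    intro k m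
    obtain ⟨l, D, hD, h⟩ :=
      (hasTemperateGrowth_quadPhase x a b c).norm_iteratedFDeriv_le_uniform m
    obtain ⟨C, hC, h'⟩ := exists_pow_mul_norm_cexp_quadPhase_le x b c ha (k + l * m)
    refine ⟨m.factorial * (1 + D) ^ m * C, fun y ↦ ?_⟩
    have hone : 1 ≤ (1 + ‖y‖) ^ l := one_le_pow₀ (by linarith [norm_nonneg y])
    have hone' : 1 ≤ (1 + D) * (1 + ‖y‖) ^ l := one_le_mul_of_one_le_of_one_le (by linarith) hone
    have := norm_iteratedFDeriv_comp_le (g := Complex.exp) (f := quadPhase x a b c)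
      (Complex.contDiff_exp (n := (m : WithTop ℕ∞))) ((hasTemperateGrowth_quadPhase x a b c).1.of_le
        (mod_cast le_top)) le_rfl y (C := ‖Complex.exp (quadPhase x a b c y)‖)
      (D := (1 + D) * (1 + ‖y‖) ^ l) (fun i _ ↦ norm_iteratedFDeriv_cexp_le i _)
      (fun i hi hi' ↦ (h i hi' y).trans <| le_trans (by gcongr; linarith)
        (le_self_pow₀ hone' (by lia)))
    calc ‖y‖ ^ k * ‖iteratedFDeriv ℝ m (fun y ↦ Complex.exp (quadPhase x a b c y)) y‖
        ≤ (1 + ‖y‖) ^ k * (m.factorial * ‖Complex.exp (quadPhase x a b c y)‖ *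
            ((1 + D) * (1 + ‖y‖) ^ l) ^ m) := by
          gcongr
          · linarith
          · exact this
      _ = m.factorial * (1 + D) ^ m *
            ((1 + ‖y‖) ^ (k + l * m) * ‖Complex.exp (quadPhase x a b c y)‖) := by
          rw [mul_pow, ← pow_mul, pow_add]; ring
      _ ≤ _ := by gcongr; exact h' y

lemma gaussian_apply (x : Space n) (a b c : ℂ) (ha : 0 < a.re) (y : Space n) :
    gaussian x a b c ha y = Complex.exp (quadPhase x a b c y) := rfl

/-- Multiplication of a Schwartz function by `‖y‖²`. -/
def mulNormSq (ψ : 𝓢(Space n, ℂ)) : 𝓢(Space n, ℂ) :=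
  SchwartzMap.smulLeftCLM ℂ (fun y : Space n ↦ ‖y‖ ^ 2) ψ

/-- Multiplication of a Schwartz function by `⟨x, y⟩`. -/
def mulInner (x : Space n) (ψ : 𝓢(Space n, ℂ)) : 𝓢(Space n, ℂ) :=
  SchwartzMap.smulLeftCLM ℂ (fun y : Space n ↦ inner ℝ x y) ψ

lemma mulNormSq_apply (ψ : 𝓢(Space n, ℂ)) (y : Space n) :
    mulNormSq ψ y = ((‖y‖ ^ 2 : ℝ) : ℂ) * ψ y := by
  rw [mulNormSq, SchwartzMap.smulLeftCLM_apply_apply (by fun_prop), Complex.real_smul]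

lemma mulInner_apply (x : Space n) (ψ : 𝓢(Space n, ℂ)) (y : Space n) :
    mulInner x ψ y = ((inner ℝ x y : ℝ) : ℂ) * ψ y := by
  rw [mulInner, SchwartzMap.smulLeftCLM_apply_apply (by fun_prop), Complex.real_smul]

lemma hamiltonian_eq (σ : ℝ → ℝ) (t : ℝ) (ψ : 𝓢(Space n, ℂ)) :
    hamiltonian σ t ψ = -((1 / 2 : ℂ) • Δ ψ) + ((σ t / 2 : ℝ) : ℂ) • mulNormSq ψ := rfl

lemma hasDerivAt_quadPhase_line (x : Space n) (a b c : ℂ) (v y : Space n) :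
    HasDerivAt (fun t : ℝ ↦ quadPhase x a b c (y + t • v))
      (b * ((inner ℝ x v : ℝ) : ℂ) - a * ((inner ℝ y v : ℝ) : ℂ)) 0 := by
  have h (t : ℝ) : quadPhase x a b c (y + t • v) = quadPhase x a b c y +
      ((t : ℂ) * (b * ((inner ℝ x v : ℝ) : ℂ) - a * ((inner ℝ y v : ℝ) : ℂ))
        - (t : ℂ) ^ 2 * (a / 2 * ((‖v‖ ^ 2 : ℝ) : ℂ))) := by
    simp only [quadPhase, inner_add_right, inner_smul_right, norm_add_sq_real, norm_smul, mul_pow,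
      Real.norm_eq_abs, sq_abs]
    push_cast
    ring
  simp_rw [h]
  have h0 : HasDerivAt (fun t : ℝ ↦ (t : ℂ)) 1 0 := Complex.ofRealCLM.hasDerivAt
  refine (((h0.mul_const _).sub ((h0.pow 2).mul_const _)).const_add _).congr_deriv ?_
  simp

lemma hasDerivAt_gaussian_line (x : Space n) (a b c : ℂ) (ha : 0 < a.re) (v y : Space n) :
    HasDerivAt (fun t : ℝ ↦ gaussian x a b c ha (y + t • v))
      ((b * ((inner ℝ x v : ℝ) : ℂ) - a * ((inner ℝ y v : ℝ) : ℂ)) * gaussian x a b c ha y) 0 := by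
  simp_rw [gaussian_apply]
  convert (hasDerivAt_quadPhase_line x a b c v y).cexp using 1
  simp [mul_comm]

open LineDeriv in
lemma lineDerivOp_eq_of_hasDerivAt {ψ : 𝓢(Space n, ℂ)} {v y : Space n} {d : ℂ}
    (h : HasDerivAt (fun t : ℝ ↦ ψ (y + t • v)) d 0) : ∂_{v} ψ y = d := by
  rw [SchwartzMap.lineDerivOp_apply_eq_fderiv, ← ψ.differentiableAt.lineDeriv_eq_fderiv]
  exact HasLineDerivAt.lineDeriv h

open LineDeriv in
lemma lineDerivOp_gaussian (x : Space n) (a b c : ℂ) (ha : 0 < a.re) (v y : Space n) :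
    ∂_{v} (gaussian x a b c ha) y =
      (b * ((inner ℝ x v : ℝ) : ℂ) - a * ((inner ℝ y v : ℝ) : ℂ)) * gaussian x a b c ha y :=
  lineDerivOp_eq_of_hasDerivAt (hasDerivAt_gaussian_line x a b c ha v y)

open LineDeriv in
lemma lineDerivOp_lineDerivOp_gaussian (x : Space n) (a b c : ℂ) (ha : 0 < a.re)
    (v y : Space n) :
    ∂_{v} (∂_{v} (gaussian x a b c ha)) y =
      ((b * ((inner ℝ x v : ℝ) : ℂ) - a * ((inner ℝ y v : ℝ) : ℂ)) ^ 2
        - a * ((‖v‖ ^ 2 : ℝ) : ℂ)) * gaussian x a b c ha y := by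
  refine lineDerivOp_eq_of_hasDerivAt ?_
  simp_rw [lineDerivOp_gaussian, inner_add_left, inner_smul_left]
  have h0 : HasDerivAt (fun t : ℝ ↦ (t : ℂ)) 1 0 := Complex.ofRealCLM.hasDerivAt
  have h1 : HasDerivAt (fun t : ℝ ↦ b * ((inner ℝ x v : ℝ) : ℂ) -
      a * ((inner ℝ y v + (starRingEnd ℝ) t * inner ℝ v v : ℝ) : ℂ))
      (-(a * ((‖v‖ ^ 2 : ℝ) : ℂ))) 0 := by
    refine (((h0.mul_const (((inner ℝ v v : ℝ)) : ℂ)).const_add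
      ((inner ℝ y v : ℝ) : ℂ)).const_mul a).const_sub (b * ((inner ℝ x v : ℝ) : ℂ))
      |>.congr_deriv (by rw [real_inner_self_eq_norm_sq, one_mul]) |>.congr_of_eventuallyEq ?_
    exact .of_forall fun t ↦ by simp
  refine (h1.mul (hasDerivAt_gaussian_line x a b c ha v y)).congr_deriv ?_
  simp
  ring

lemma laplacian_gaussian (x : Space n) (a b c : ℂ) (ha : 0 < a.re) :
    Δ (gaussian x a b c ha) = (b ^ 2 * ‖x‖ ^ 2 - n * a) • gaussian x a b c ha
      - (2 * a * b) • mulInner x (gaussian x a b c ha)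
      + a ^ 2 • mulNormSq (gaussian x a b c ha) := by
  ext y
  set e := EuclideanSpace.basisFun (Fin n) ℝ with he
  have h1 : ∑ i, ((inner ℝ x (e i) : ℝ) : ℂ) ^ 2 = ((‖x‖ ^ 2 : ℝ) : ℂ) := by
    rw [← e.sum_sq_inner_left x]; push_cast; rfl
  have h2 : ∑ i, ((inner ℝ y (e i) : ℝ) : ℂ) ^ 2 = ((‖y‖ ^ 2 : ℝ) : ℂ) := by
    rw [← e.sum_sq_inner_left y]; push_cast; rfl
  have h3 : ∑ i, ((inner ℝ x (e i) : ℝ) : ℂ) * ((inner ℝ y (e i) : ℝ) : ℂ) =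
      ((inner ℝ x y : ℝ) : ℂ) := by
    rw [← e.sum_inner_mul_inner x y]; push_cast; simp_rw [real_inner_comm]
  rw [SchwartzMap.laplacian_eq_sum e, _root_.sum_apply]
  simp_rw [lineDerivOp_lineDerivOp_gaussian]
  rw [← Finset.sum_mul]
  have h4 : ∑ i, ((b * ((inner ℝ x (e i) : ℝ) : ℂ) - a * ((inner ℝ y (e i) : ℝ) : ℂ)) ^ 2
      - a * ((‖e i‖ ^ 2 : ℝ) : ℂ)) = b ^ 2 * ∑ i, ((inner ℝ x (e i) : ℝ) : ℂ) ^ 2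
      - 2 * a * b * ∑ i, ((inner ℝ x (e i) : ℝ) : ℂ) * ((inner ℝ y (e i) : ℝ) : ℂ)
      + a ^ 2 * ∑ i, ((inner ℝ y (e i) : ℝ) : ℂ) ^ 2 - n * a := by
    have h5 (i : Fin n) : ‖e i‖ = 1 := e.norm_eq_one i
    simp_rw [h5, Finset.sum_sub_distrib, sub_sq, Finset.sum_add_distrib, Finset.sum_sub_distrib,
      Finset.mul_sum]
    simp only [mul_pow]
    simp
    exact Finset.sum_congr rfl fun i _ ↦ by ring
  rw [h4, h1, h2, h3]
  simp only [add_apply, sub_apply, smul_apply, mulInner_apply, mulNormSq_apply, smul_eq_mul]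
  push_cast
  ring

/-- Second order Taylor bound for `z ↦ e^z`, with the quadratic factor absorbed into the
exponential. -/
lemma norm_cexp_sub_one_sub_le {z : ℂ} {d η m : ℝ} (hη : 0 < η) (hdη : d ≤ η)
    (hm : 0 ≤ m) (hz : ‖z‖ ≤ d * m) :
    ‖Complex.exp z - 1 - z‖ ≤ 2 / η ^ 2 * d ^ 2 * Real.exp (2 * η * m) := by
  have h1 := Complex.norm_exp_sub_sum_le_norm_mul_exp z 2
  simp only [Finset.sum_range_succ, Finset.range_zero, Finset.sum_empty, pow_zero, pow_one,
    Nat.factorial, Nat.cast_one, div_one, zero_add] at h1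
  have h2 : (η * m) ^ 2 ≤ 2 * Real.exp (η * m) := by
    have := Real.pow_div_factorial_le_exp (x := η * m) (by positivity) 2
    rw [div_le_iff₀ (by positivity)] at this
    simpa [mul_comm] using this
  calc ‖Complex.exp z - 1 - z‖ ≤ ‖z‖ ^ 2 * Real.exp ‖z‖ := by
        rw [sub_sub]; simpa using h1
    _ ≤ (d * m) ^ 2 * Real.exp (η * m) := by
        gcongr
        exact hz.trans (by gcongr)
    _ = d ^ 2 / η ^ 2 * (η * m) ^ 2 * Real.exp (η * m) := by field_simp
    _ ≤ d ^ 2 / η ^ 2 * (2 * Real.exp (η * m)) * Real.exp (η * m) := by gcongr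
    _ = 2 / η ^ 2 * d ^ 2 * (Real.exp (η * m) * Real.exp (η * m)) := by ring
    _ = _ := by rw [← Real.exp_add]; ring_nf

lemma coeFn_toL2 (ψ : 𝓢(Space n, ℂ)) : (toL2 ψ : Space n → ℂ) =ᵐ[volume] ψ :=
  ψ.coeFn_toLp 2 volume

lemma toL2_add (ψ χ : 𝓢(Space n, ℂ)) : toL2 (ψ + χ) = toL2 ψ + toL2 χ := rfl
lemma toL2_sub (ψ χ : 𝓢(Space n, ℂ)) : toL2 (ψ - χ) = toL2 ψ - toL2 χ := rfl
lemma toL2_smul (z : ℂ) (ψ : 𝓢(Space n, ℂ)) : toL2 (z • ψ) = z • toL2 ψ := rfl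

lemma norm_toL2_le_of_forall_le {ψ χ : 𝓢(Space n, ℂ)} {C : ℝ} (h : ∀ y, ‖ψ y‖ ≤ C * ‖χ y‖) :
    ‖toL2 ψ‖ ≤ C * ‖toL2 χ‖ := by
  refine Lp.norm_le_mul_norm_of_ae_le_mul ?_
  filter_upwards [coeFn_toL2 ψ, coeFn_toL2 χ] with y h1 h2
  rw [h1, h2]
  exact h y

/-- The dependence of a Gaussian in `L²` on its parameters is differentiable, with a quadratic
remainder. -/
lemma exists_norm_gaussian_sub_le (x : Space n) (a b c : ℂ) (ha : 0 < a.re) :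
    ∃ C η : ℝ, 0 < η ∧ ∀ (a' b' c' : ℂ) (ha' : 0 < a'.re),
      ‖a' - a‖ + ‖b' - b‖ + ‖c' - c‖ ≤ η →
      ‖toL2 (gaussian x a' b' c' ha') - toL2 (gaussian x a b c ha) -
        ((c' - c) • toL2 (gaussian x a b c ha) + (b' - b) • toL2 (mulInner x (gaussian x a b c ha))
          - ((a' - a) / 2) • toL2 (mulNormSq (gaussian x a b c ha)))‖
        ≤ C * (‖a' - a‖ + ‖b' - b‖ + ‖c' - c‖) ^ 2 := by
  set K := 1 + ‖x‖ with hK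
  have hK1 : 1 ≤ K := by simp [hK]
  set η := a.re / (8 * K) with hη
  have hη0 : 0 < η := by positivity
  have h8 : 8 * η * K = a.re := by rw [hη]; field_simp
  -- the Gaussian with slightly smaller width parameter dominates the remainder
  have ha1 : 0 < (a - ((4 * η * K : ℝ) : ℂ)).re := by simp; linarith
  set G := gaussian x (a - ((4 * η * K : ℝ) : ℂ)) b (c + ((2 * η * K : ℝ) : ℂ)) ha1 with hG
  refine ⟨2 / η ^ 2 * ‖toL2 G‖, η, hη0, fun a' b' c' ha' hd ↦ ?_⟩
  set d := ‖a' - a‖ + ‖b' - b‖ + ‖c' - c‖ with hd'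
  have hd0 : 0 ≤ d := by positivity
  rw [mul_right_comm]
  refine norm_toL2_le_of_forall_le (ψ := gaussian x a' b' c' ha' - gaussian x a b c ha -
    ((c' - c) • gaussian x a b c ha + (b' - b) • mulInner x (gaussian x a b c ha)
      - ((a' - a) / 2) • mulNormSq (gaussian x a b c ha))) fun y ↦ ?_
  set z := quadPhase x (a' - a) (b' - b) (c' - c) y with hz
  have hxy : ‖x‖ * ‖y‖ ≤ ‖x‖ * (1 + ‖y‖ ^ 2) := by
    gcongr; nlinarith [sq_nonneg (‖y‖ - 1)]
  have hzn : ‖z‖ ≤ d * (K * (1 + ‖y‖ ^ 2)) := by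
    calc ‖z‖ ≤ ‖c' - c‖ + ‖b' - b‖ * (‖x‖ * ‖y‖) + ‖a' - a‖ / 2 * ‖y‖ ^ 2 := by
          refine (norm_sub_le _ _).trans (add_le_add ((norm_add_le _ _).trans ?_) ?_)
          · rw [norm_mul, Complex.norm_real]
            gcongr
            exact abs_real_inner_le_norm x y
          · simp
      _ ≤ ‖c' - c‖ * (K * (1 + ‖y‖ ^ 2)) + ‖b' - b‖ * (K * (1 + ‖y‖ ^ 2))
          + ‖a' - a‖ * (K * (1 + ‖y‖ ^ 2)) := by
          have h1 : ‖y‖ ^ 2 / 2 ≤ K * (1 + ‖y‖ ^ 2) := by nlinarith [sq_nonneg ‖y‖]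
          have h2 : 1 ≤ K * (1 + ‖y‖ ^ 2) := by nlinarith [sq_nonneg ‖y‖]
          have h3 : ‖x‖ * ‖y‖ ≤ K * (1 + ‖y‖ ^ 2) := by nlinarith [sq_nonneg ‖y‖]
          rw [div_mul_eq_mul_div, mul_div_assoc]
          gcongr
          exact le_mul_of_one_le_right (norm_nonneg _) h2
      _ = d * (K * (1 + ‖y‖ ^ 2)) := by rw [hd']; ring
  have key : (gaussian x a' b' c' ha' - gaussian x a b c ha -
      ((c' - c) • gaussian x a b c ha + (b' - b) • mulInner x (gaussian x a b c ha)
        - ((a' - a) / 2) • mulNormSq (gaussian x a b c ha))) y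
      = (Complex.exp z - 1 - z) * Complex.exp (quadPhase x a b c y) := by
    have : quadPhase x a' b' c' y = z + quadPhase x a b c y := by
      rw [hz]; simp only [quadPhase]; ring
    simp only [add_apply, sub_apply, smul_apply, mulInner_apply, mulNormSq_apply, smul_eq_mul,
      gaussian_apply, this, Complex.exp_add]
    rw [hz, quadPhase]
    ring
  rw [key, norm_mul, hG, gaussian_apply, Complex.norm_exp (quadPhase x (a - _) b _ y)]
  have hre : (quadPhase x (a - ((4 * η * K : ℝ) : ℂ)) b (c + ((2 * η * K : ℝ) : ℂ)) y).re
      = 2 * η * (K * (1 + ‖y‖ ^ 2)) + (quadPhase x a b c y).re := by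
    rw [re_quadPhase, re_quadPhase, Complex.sub_re, Complex.add_re, Complex.ofReal_re,
      Complex.ofReal_re]
    ring
  rw [hre, Real.exp_add, ← Complex.norm_exp, ← mul_assoc]
  gcongr
  exact norm_cexp_sub_one_sub_le hη0 hd (by positivity) hzn

end Gaussian

/-! ### Stationarity of inner products with evolving Gaussians -/

section Calculus

variable {E : Type*} [NormedAddCommGroup E] [NormedSpace ℝ E] [CompleteSpace E]

/-- For a bounded `σ` neither `∫ σ k` nor `k ∫ σ` need be differentiable, but the difference of
their increments is negligible at every point. This replaces the product rule for `k ∫ σ`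
at times where `∫ σ` is not differentiable. -/
lemma hasDerivAt_integral_smul_sub {σ : ℝ → ℝ} {M : ℝ} (hσ : ∀ᵐ s, |σ s| ≤ M)
    (hσi : ∀ a b, IntervalIntegrable σ volume a b) {k : ℝ → E} (hk : Continuous k) (t : ℝ) :
    HasDerivAt (fun x ↦ (∫ s in t..x, σ s • k s) - (∫ s in t..x, σ s) • k x) 0 t := by
  have hM : 0 ≤ M := by
    obtain ⟨s, hs⟩ := hσ.exists
    exact (abs_nonneg _).trans hs
  have h (x : ℝ) : (∫ s in t..x, σ s • k s) - (∫ s in t..x, σ s) • k x =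
      ∫ s in t..x, σ s • (k s - k x) := by
    rw [← intervalIntegral.integral_smul_const, ← intervalIntegral.integral_sub]
    · simp_rw [smul_sub]
    · exact (hσi t x).smul_continuousOn hk.continuousOn
    · exact (hσi t x).smul_continuousOn continuousOn_const
  simp_rw [h]
  rw [hasDerivAt_iff_isLittleO, Asymptotics.isLittleO_iff]
  intro ε hε
  obtain ⟨δ, hδ, hδk⟩ := Metric.continuousAt_iff.1 hk.continuousAt (ε / (2 * (M + 1)))
    (by positivity : 0 < ε / (2 * (M + 1)))
  filter_upwards [Metric.ball_mem_nhds t hδ] with x hx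
  simp only [intervalIntegral.integral_same, smul_zero, sub_zero]
  refine intervalIntegral.norm_integral_le_of_norm_le_const_ae (hσ.mono fun s hs hst ↦ ?_)
  have hsx : dist s t < δ := by
    rw [dist_comm]
    exact (Real.dist_left_le_of_mem_uIcc (Set.uIoc_subset_uIcc hst)).trans_lt
      (by rwa [Metric.mem_ball, dist_comm] at hx)
  have h1 : ‖k s - k x‖ ≤ ε / (2 * (M + 1)) + ε / (2 * (M + 1)) := by
    rw [← dist_eq_norm]
    exact (dist_triangle_right _ _ _).trans (add_le_add (hδk hsx).le (hδk hx).le)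
  calc ‖σ s • (k s - k x)‖ = |σ s| * ‖k s - k x‖ := by rw [norm_smul, Real.norm_eq_abs]
    _ ≤ (M + 1) * (ε / (2 * (M + 1)) + ε / (2 * (M + 1))) := by gcongr; linarith
    _ = ε := by field_simp; ring

/-- Product rule at a zero of `f`: continuity of the other factor suffices. -/
lemma hasDerivAt_mul_of_eq_zero {f k : ℝ → ℂ} {f' : ℂ} {t : ℝ} (hf : HasDerivAt f f' t)
    (h0 : f t = 0) (hk : ContinuousAt k t) : HasDerivAt (fun s ↦ f s * k s) (f' * k t) t := by
  rw [hasDerivAt_iff_tendsto_slope] at hf ⊢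
  refine (hf.mul (hk.tendsto.mono_left nhdsWithin_le_nhds)).congr fun s ↦ ?_
  simp [slope_def_module, h0, mul_assoc]

lemma hasDerivAt_zero_of_norm_le_sq {f : ℝ → ℂ} {d : ℝ → ℝ} {t C : ℝ}
    (hd : d =O[𝓝 t] fun s ↦ s - t) (hf : ∀ᶠ s in 𝓝 t, ‖f s‖ ≤ C * d s ^ 2) :
    HasDerivAt f 0 t := by
  have h0 : f t = 0 := by
    have h1 : d t = 0 := hd.eq_zero_imp.self_of_nhds (by simp)
    simpa [h1] using hf.self_of_nhds
  rw [hasDerivAt_iff_isLittleO]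
  simp only [h0, smul_zero, sub_zero]
  have h1 : f =O[𝓝 t] fun s ↦ (s - t) ^ 2 :=
    (Asymptotics.IsBigO.of_bound C (hf.mono fun s hs ↦ by simpa using hs)).trans (hd.pow 2)
  refine h1.trans_isLittleO ?_
  have h2 : (fun s : ℝ ↦ s - t) =o[𝓝 t] fun _ ↦ (1 : ℝ) := by
    rw [Asymptotics.isLittleO_one_iff]
    have : Continuous fun s : ℝ ↦ s - t := by fun_prop
    simpa using this.tendsto t
  simpa [pow_two] using h2.mul_isBigO (Asymptotics.isBigO_refl (fun s : ℝ ↦ s - t) (𝓝 t))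

end Calculus

section Evolution

variable {n : ℕ} {σ : ℝ → ℝ} {U : ℝ → ℝ → (L2 n ≃ₗᵢ[ℂ] L2 n)}

lemma IsPropagator.inner_eq (hU : IsPropagator σ U) (φ ψ : 𝓢(Space n, ℂ)) (t s : ℝ) :
    inner ℂ (toL2 ψ) (U s 0 (toL2 φ)) = inner ℂ (toL2 ψ) (U t 0 (toL2 φ)) -
      Complex.I * ∫ r in t..s, inner ℂ (toL2 (hamiltonian σ r ψ)) (U r 0 (toL2 φ)) := by
  have h1 := hU.forward 0 s φ ψ
  have h2 := hU.forward 0 t φ ψ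
  have h3 := intervalIntegral.integral_interval_sub_left (hU.forward_integrable 0 s φ ψ)
    (hU.forward_integrable 0 t φ ψ)
  rw [← h3, ← h1, ← h2]
  linear_combination (inner ℂ (toL2 ψ) (U s 0 (toL2 φ)) - inner ℂ (toL2 ψ) (U t 0 (toL2 φ))) *
    Complex.I_sq

lemma IsPropagator.continuous_inner (hU : IsPropagator σ U) (φ ψ : 𝓢(Space n, ℂ)) :
    Continuous fun s ↦ inner ℂ (toL2 ψ) (U s 0 (toL2 φ)) := by
  have h : ∀ a b, IntervalIntegrable
      (fun r ↦ inner ℂ (toL2 (hamiltonian σ r ψ)) (U r 0 (toL2 φ))) volume a b := fun a b ↦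
    (hU.forward_integrable 0 a φ ψ).symm.trans (hU.forward_integrable 0 b φ ψ)
  have : (fun s ↦ inner ℂ (toL2 ψ) (U s 0 (toL2 φ))) = fun s ↦
      inner ℂ (toL2 ψ) (U 0 0 (toL2 φ)) - Complex.I *
        ∫ r in 0..s, inner ℂ (toL2 (hamiltonian σ r ψ)) (U r 0 (toL2 φ)) :=
    funext fun s ↦ hU.inner_eq φ ψ 0 s
  rw [this]
  exact continuous_const.sub (continuous_const.mul (intervalIntegral.continuous_primitive h 0))

/-- If the parameters of a Gaussian solve the equations that turn it into a classical solution of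
`i ∂ₜ v = H₀(t) v`, then its inner product with `U(t,0) φ` is stationary at every time. The equation
`a' = i (σ - a²)` for the width is imposed on `a - i ∫ σ`, which is differentiable everywhere. -/
theorem IsPropagator.hasDerivAt_inner_gaussian (hU : IsPropagator σ U) {M : ℝ}
    (hσ : ∀ᵐ s, |σ s| ≤ M) (hσi : ∀ a b, IntervalIntegrable σ volume a b)
    (φ : 𝓢(Space n, ℂ)) (x : Space n) {a b c : ℝ → ℂ} (ha : ∀ s, 0 < (a s).re) {t : ℝ}
    (hda : HasDerivAt (fun s ↦ a s - Complex.I * ((∫ r in 0..s, σ r : ℝ) : ℂ))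
      (-Complex.I * a t ^ 2) t)
    (hdb : HasDerivAt b (-Complex.I * a t * b t) t)
    (hdc : HasDerivAt c (Complex.I / 2 * (b t ^ 2 * ‖x‖ ^ 2 - n * a t)) t) :
    HasDerivAt (fun s ↦ inner ℂ (toL2 (gaussian x (a s) (b s) (c s) (ha s)))
      (U s 0 (toL2 φ))) 0 t := by
  set g := gaussian x (a t) (b t) (c t) (ha t) with hg
  set u : ℝ → L2 n := fun s ↦ U s 0 (toL2 φ) with hu
  set k₀ : ℝ → ℂ := fun s ↦ inner ℂ (toL2 g) (u s) with hk₀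
  set k₁ : ℝ → ℂ := fun s ↦ inner ℂ (toL2 (mulInner x g)) (u s) with hk₁
  set k₂ : ℝ → ℂ := fun s ↦ inner ℂ (toL2 (mulNormSq g)) (u s) with hk₂
  set k₃ : ℝ → ℂ := fun s ↦ inner ℂ (toL2 (Δ g)) (u s) with hk₃
  have hc₀ : Continuous k₀ := hU.continuous_inner φ g
  have hc₁ : Continuous k₁ := hU.continuous_inner φ (mulInner x g)
  have hc₂ : Continuous k₂ := hU.continuous_inner φ (mulNormSq g)
  have hc₃ : Continuous k₃ := hU.continuous_inner φ (Δ g)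
  have h2c : (starRingEnd ℂ) 2 = 2 := Complex.conj_ofNat 2
  set S : ℝ → ℝ := fun s ↦ ∫ r in 0..s, σ r with hS
  have hSt (s : ℝ) : S s - S t = ∫ r in t..s, σ r :=
    intervalIntegral.integral_interval_sub_left (hσi 0 s) (hσi 0 t)
  set A : ℝ → ℂ := fun s ↦ a s - Complex.I * (S s : ℂ) with hA
  have haA (s : ℝ) : a s - a t = (A s - A t) + Complex.I * ((S s - S t : ℝ) : ℂ) := by
    simp only [hA]; push_cast; ring
  set ℓ : ℝ → L2 n := fun s ↦ (c s - c t) • toL2 g + (b s - b t) • toL2 (mulInner x g)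
    - ((a s - a t) / 2) • toL2 (mulNormSq g) with hℓ
  set R : ℝ → ℂ := fun s ↦ inner ℂ
    (toL2 (gaussian x (a s) (b s) (c s) (ha s)) - toL2 g - ℓ s) (u s) with hR
  have hSO : (fun s ↦ S s - S t) =O[𝓝 t] fun s ↦ s - t := by
    refine Asymptotics.IsBigO.of_bound M (.of_forall fun s ↦ ?_)
    rw [hSt]
    exact intervalIntegral.norm_integral_le_of_norm_le_const_ae (hσ.mono fun r hr _ ↦ hr)
  -- the remainder of the expansion in the parameters
  have hRd : HasDerivAt R 0 t := by
    have haO : (fun s ↦ a s - a t) =O[𝓝 t] fun s ↦ s - t := by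
      simp_rw [haA]
      refine hda.isBigO_sub.add (Asymptotics.IsBigO.trans (.of_bound 1 (.of_forall fun s ↦ ?_)) hSO)
      rw [norm_mul, Complex.norm_I, Complex.norm_real]
    have hdO := ((haO.norm_left.add hdb.isBigO_sub.norm_left).add hdc.isBigO_sub.norm_left)
    obtain ⟨C, η, hη, h⟩ := exists_norm_gaussian_sub_le x (a t) (b t) (c t) (ha t)
    refine hasDerivAt_zero_of_norm_le_sq (C := C * ‖toL2 φ‖) hdO ?_
    have h0 : Tendsto (fun s ↦ ‖a s - a t‖ + ‖b s - b t‖ + ‖c s - c t‖) (𝓝 t) (𝓝 0) :=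
      hdO.trans_tendsto (by
        have : Continuous fun s : ℝ ↦ s - t := by fun_prop
        simpa using this.tendsto t)
    filter_upwards [h0.eventually_le_const hη] with s hs
    calc ‖R s‖ ≤ _ * ‖u s‖ := norm_inner_le_norm _ _
      _ ≤ (C * (‖a s - a t‖ + ‖b s - b t‖ + ‖c s - c t‖) ^ 2) * ‖toL2 φ‖ := by
        rw [hu]
        simp only [LinearIsometryEquiv.norm_map]
        exact mul_le_mul_of_nonneg_right (h _ _ _ (ha s) hs) (norm_nonneg _)
      _ = _ := by ring
  have hH (r : ℝ) : inner ℂ (toL2 (hamiltonian σ r g)) (u r) =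
      -(1 / 2) * k₃ r + (1 / 2) * (σ r • k₂ r) := by
    rw [hamiltonian_eq, toL2_add, ← neg_smul, toL2_smul, toL2_smul, inner_add_left,
      inner_smul_left, inner_smul_left, Complex.conj_ofReal, Complex.real_smul]
    simp only [map_neg, map_div₀, map_one, Complex.conj_ofNat]
    push_cast
    ring
  -- the increments of `∫ σ` cancel between the Gaussian and the propagator
  have hF (s : ℝ) : inner ℂ (toL2 (gaussian x (a s) (b s) (c s) (ha s))) (u s) =
      R s + star (c s - c t) * k₀ s + star (b s - b t) * k₁ s
        - (1 / 2) * (star (A s - A t) * k₂ s) + k₀ t + Complex.I / 2 * (∫ r in t..s, k₃ r)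
        - Complex.I / 2 * ((∫ r in t..s, σ r • k₂ r) - (∫ r in t..s, σ r) • k₂ s) := by
    have h1 : inner ℂ (toL2 (gaussian x (a s) (b s) (c s) (ha s))) (u s) =
        R s + inner ℂ (ℓ s) (u s) + k₀ s := by
      simp only [hR, hk₀, inner_sub_left]; ring
    have h2 : k₀ s = k₀ t - Complex.I * (-(1 / 2) * (∫ r in t..s, k₃ r) +
        (1 / 2) * ∫ r in t..s, σ r • k₂ r) := by
      have h3 := hU.inner_eq φ g t s
      have h4 : IntervalIntegrable (fun r ↦ σ r • k₂ r) volume t s :=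
        (hσi t s).smul_continuousOn hc₂.continuousOn
      rw [funext hH, intervalIntegral.integral_add ((hc₃.intervalIntegrable t s).const_mul _)
        (h4.const_mul _), intervalIntegral.integral_const_mul,
        intervalIntegral.integral_const_mul] at h3
      exact h3
    have h3 : inner ℂ (ℓ s) (u s) = star (c s - c t) * k₀ s + star (b s - b t) * k₁ s
        - (1 / 2) * (star (A s - A t) * k₂ s) + Complex.I / 2 * ((∫ r in t..s, σ r) • k₂ s) := by
      rw [hℓ]
      simp only [inner_sub_left, inner_add_left, inner_smul_left, haA, ← hSt, Complex.real_smul,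
        map_div₀, map_add, map_mul, Complex.conj_ofReal, Complex.conj_I, h2c, ← starRingEnd_apply,
        hk₀, hk₁, hk₂]
      ring
    rw [h1, h3, h2]
    ring
  have e0 := hasDerivAt_mul_of_eq_zero (hdc.sub_const (c t)).star (by simp) hc₀.continuousAt
  have e1 := hasDerivAt_mul_of_eq_zero (hdb.sub_const (b t)).star (by simp) hc₁.continuousAt
  have e2 := hasDerivAt_mul_of_eq_zero (hda.sub_const (A t)).star (by simp [hA, hS])
    hc₂.continuousAt
  have e3 : HasDerivAt (fun s ↦ ∫ r in t..s, k₃ r) (k₃ t) t :=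
    intervalIntegral.integral_hasDerivAt_right (hc₃.intervalIntegrable _ _)
      (hc₃.stronglyMeasurableAtFilter _ _) hc₃.continuousAt
  have e4 := hasDerivAt_integral_smul_sub hσ hσi hc₂ t
  have hk3 : k₃ t = star (b t ^ 2 * ‖x‖ ^ 2 - n * a t) * k₀ t - 2 * star (a t * b t) * k₁ t
      + star (a t ^ 2) * k₂ t := by
    simp only [hk₃, hg, laplacian_gaussian, toL2_add, toL2_sub, toL2_smul, inner_add_left,
      inner_sub_left, inner_smul_left, hk₀, hk₁, hk₂]
    simp only [Complex.star_def, map_sub, map_mul, map_pow, map_natCast, Complex.conj_ofReal, h2c]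
    ring
  refine (((((((hRd.add e0).add e1).sub (e2.const_mul (1 / 2))).add_const (k₀ t)).add
    (e3.const_mul (Complex.I / 2))).sub (e4.const_mul (Complex.I / 2))).congr_of_eventuallyEq
    (.of_forall hF)).congr_deriv ?_
  rw [hk3]
  simp
  ring

end Evolution

/-! ### Linear differential equations with bounded coefficient, and the evolution of Gaussians -/

section ODE

variable {σ ζ ζ₁ ζ₂ : ℝ → ℝ} {M p q : ℝ}

lemma SolvesIVP.hasDerivAt (h : SolvesIVP σ ζ p q) (t : ℝ) : HasDerivAt ζ (deriv ζ t) t :=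
  (h.contDiff.differentiable (by simp) t).hasDerivAt

lemma SolvesIVP.continuous_deriv (h : SolvesIVP σ ζ p q) : Continuous (deriv ζ) :=
  h.contDiff.continuous_deriv le_rfl

/-- The quasi-derivative `ζ' + (∫ σ) ζ` of a solution of `ζ'' + σ ζ = 0` is differentiable at every
time, while `ζ'` itself is only differentiable almost everywhere. -/
lemma SolvesIVP.hasDerivAt_quasiDeriv (h : SolvesIVP σ ζ p q) (hσ : ∀ᵐ s, |σ s| ≤ M)
    (hσi : ∀ a b, IntervalIntegrable σ volume a b) (t : ℝ) :
    HasDerivAt (fun s ↦ deriv ζ s + (∫ r in 0..s, σ r) * ζ s)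
      ((∫ r in 0..t, σ r) * deriv ζ t) t := by
  have hi (a b : ℝ) : IntervalIntegrable (fun r ↦ σ r * ζ r) volume a b :=
    (hσi a b).mul_continuousOn h.contDiff.continuous.continuousOn
  have key := hasDerivAt_integral_smul_sub hσ hσi h.contDiff.continuous t
  have h1 (s : ℝ) : deriv ζ s + (∫ r in 0..s, σ r) * ζ s = deriv ζ t + (∫ r in 0..t, σ r) * ζ s
      - ((∫ r in t..s, σ r • ζ r) - (∫ r in t..s, σ r) • ζ s) := by
    simp only [smul_eq_mul]
    rw [h.deriv_eq s, h.deriv_eq t,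
      ← intervalIntegral.integral_interval_sub_left (hσi 0 s) (hσi 0 t),
      ← intervalIntegral.integral_interval_sub_left (hi 0 s) (hi 0 t)]
    ring
  refine ((((h.hasDerivAt t).const_mul (∫ r in 0..t, σ r)).const_add (deriv ζ t)).sub key
    |>.congr_of_eventuallyEq (.of_forall h1)).congr_deriv (by simp)

lemma wronskian_eq_one (h₁ : SolvesIVP σ ζ₁ 1 0) (h₂ : SolvesIVP σ ζ₂ 0 1)
    (hσ : ∀ᵐ s, |σ s| ≤ M) (hσi : ∀ a b, IntervalIntegrable σ volume a b) (t : ℝ) :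
    ζ₁ t * deriv ζ₂ t - deriv ζ₁ t * ζ₂ t = 1 := by
  set W : ℝ → ℝ := fun s ↦ ζ₁ s * (deriv ζ₂ s + (∫ r in 0..s, σ r) * ζ₂ s)
    - (deriv ζ₁ s + (∫ r in 0..s, σ r) * ζ₁ s) * ζ₂ s with hW
  have hd (s : ℝ) : HasDerivAt W 0 s := by
    refine (((h₁.hasDerivAt s).mul (h₂.hasDerivAt_quasiDeriv hσ hσi s)).sub
      ((h₁.hasDerivAt_quasiDeriv hσ hσi s).mul (h₂.hasDerivAt s))).congr_deriv ?_
    ring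
  have h0 : W t = W 0 := is_const_of_deriv_eq_zero (fun s ↦ (hd s).differentiableAt)
    (fun s ↦ (hd s).deriv) t 0
  have h3 : W 0 = 1 := by
    simp [hW, h₁.init, h₂.init, h₁.deriv_eq, h₂.deriv_eq]
  rw [← h3, ← h0, hW]
  ring

/-- Two real functions `u`, `v` with `u v' - u' v = 1` that solve `ζ'' + S' ζ = 0`, the equation
being imposed on the quasi-derivative `ζ' + S ζ`. -/
structure FundamentalPair (S u v : ℝ → ℝ) : Prop where
  contDiff_left : ContDiff ℝ 1 u
  contDiff_right : ContDiff ℝ 1 v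
  hasDerivAt_left (t : ℝ) : HasDerivAt (fun s ↦ deriv u s + S s * u s) (S t * deriv u t) t
  hasDerivAt_right (t : ℝ) : HasDerivAt (fun s ↦ deriv v s + S s * v s) (S t * deriv v t) t
  wronskian (t : ℝ) : u t * deriv v t - deriv u t * v t = 1

/-- The fundamental solutions with Cauchy data `(1, 0)` and `(0, 1)` at time `T`. -/
lemma fundamentalPair_at (h₁ : SolvesIVP σ ζ₁ 1 0) (h₂ : SolvesIVP σ ζ₂ 0 1)
    (hσ : ∀ᵐ s, |σ s| ≤ M) (hσi : ∀ a b, IntervalIntegrable σ volume a b) (T : ℝ) :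
    FundamentalPair (fun s ↦ ∫ r in 0..s, σ r)
      (fun s ↦ deriv ζ₂ T * ζ₁ s - deriv ζ₁ T * ζ₂ s)
      (fun s ↦ ζ₁ T * ζ₂ s - ζ₂ T * ζ₁ s) := by
  have hd (α β : ℝ) (f g : ℝ → ℝ) (p q p' q' : ℝ) (hf : SolvesIVP σ f p q)
      (hg : SolvesIVP σ g p' q') (t : ℝ) :
      deriv (fun s ↦ α * f s - β * g s) t = α * deriv f t - β * deriv g t :=
    (((hf.hasDerivAt t).const_mul α).sub ((hg.hasDerivAt t).const_mul β)).deriv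
  have hq (α β : ℝ) (f g : ℝ → ℝ) (p q p' q' : ℝ) (hf : SolvesIVP σ f p q)
      (hg : SolvesIVP σ g p' q') (t : ℝ) : HasDerivAt (fun s ↦
        deriv (fun s ↦ α * f s - β * g s) s + (∫ r in 0..s, σ r) * (α * f s - β * g s))
        ((∫ r in 0..t, σ r) * deriv (fun s ↦ α * f s - β * g s) t) t := by
    simp_rw [hd α β f g p q p' q' hf hg]
    refine (((hf.hasDerivAt_quasiDeriv hσ hσi t).const_mul α).sub
      ((hg.hasDerivAt_quasiDeriv hσ hσi t).const_mul β)).congr_deriv (by ring)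
      |>.congr_of_eventuallyEq (.of_forall fun s ↦ by simp only [Pi.sub_apply]; ring)
  refine ⟨?_, ?_, hq _ _ _ _ _ _ _ _ h₁ h₂, hq _ _ _ _ _ _ _ _ h₂ h₁, fun t ↦ ?_⟩
  · exact (contDiff_const.mul h₁.contDiff).sub (contDiff_const.mul h₂.contDiff)
  · exact (contDiff_const.mul h₂.contDiff).sub (contDiff_const.mul h₁.contDiff)
  · rw [hd _ _ _ _ _ _ _ _ h₁ h₂, hd _ _ _ _ _ _ _ _ h₂ h₁]
    have hT := wronskian_eq_one h₁ h₂ hσ hσi T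
    have ht := wronskian_eq_one h₁ h₂ hσ hσi t
    linear_combination hT + (ζ₁ T * deriv ζ₂ T - deriv ζ₁ T * ζ₂ T) * ht

end ODE

namespace FundamentalPair

variable {S u v : ℝ → ℝ} {ε T : ℝ} {n : ℕ}

/-- The complex solution `w = ε u + i v`; it has no zeros when `ε > 0`. -/
def sol (u v : ℝ → ℝ) (ε : ℝ) (s : ℝ) : ℂ := (ε * u s : ℝ) + (v s : ℝ) * Complex.I

/-- The derivative of `w`. -/
def solDeriv (u v : ℝ → ℝ) (ε : ℝ) (s : ℝ) : ℂ := (ε * deriv u s : ℝ) + (deriv v s : ℝ) * Complex.I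

/-- The primitive of `w' / w` with the value `log ε` at time `T`; it is a continuous logarithm of
`w` when `w(T) = ε`. -/
def logSol (u v : ℝ → ℝ) (ε T : ℝ) (s : ℝ) : ℂ :=
  Real.log ε + ∫ r in T..s, solDeriv u v ε r / sol u v ε r

/-- The width parameter `-i w' / w` of the evolving Gaussian. -/
def width (u v : ℝ → ℝ) (ε : ℝ) (s : ℝ) : ℂ := -Complex.I * (solDeriv u v ε s / sol u v ε s)

/-- The logarithm of the amplitude, `- u ‖x‖² / (2 w) - (n / 2) log w`, of the evolving Gaussian. -/
def logAmplitude (x : Space n) (u v : ℝ → ℝ) (ε T : ℝ) (s : ℝ) : ℂ :=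
  -(((u s : ℝ) : ℂ) / sol u v ε s * (‖x‖ ^ 2 / 2)) - n / 2 * logSol u v ε T s

lemma hasDerivAt_left' (h : FundamentalPair S u v) (t : ℝ) : HasDerivAt u (deriv u t) t :=
  (h.contDiff_left.differentiable (by simp) t).hasDerivAt

lemma hasDerivAt_right' (h : FundamentalPair S u v) (t : ℝ) : HasDerivAt v (deriv v t) t :=
  (h.contDiff_right.differentiable (by simp) t).hasDerivAt

lemma sol_ne_zero (h : FundamentalPair S u v) (hε : 0 < ε) (s : ℝ) : sol u v ε s ≠ 0 := by
  intro h0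
  have h1 : ε * u s = 0 := by simpa [sol] using congrArg Complex.re h0
  have h2 : v s = 0 := by simpa [sol] using congrArg Complex.im h0
  have h3 : u s = 0 := (mul_eq_zero.1 h1).resolve_left hε.ne'
  simpa [h2, h3] using h.wronskian s

lemma hasDerivAt_sol (h : FundamentalPair S u v) (t : ℝ) :
    HasDerivAt (sol u v ε) (solDeriv u v ε t) t :=
  ((h.hasDerivAt_left' t).const_mul ε).ofReal_comp.add
    ((h.hasDerivAt_right' t).ofReal_comp.mul_const Complex.I)

lemma hasDerivAt_quasiDeriv_sol (h : FundamentalPair S u v) (t : ℝ) :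
    HasDerivAt (fun s ↦ solDeriv u v ε s + S s * sol u v ε s) (S t * solDeriv u v ε t) t := by
  refine (((h.hasDerivAt_left t).const_mul ε).ofReal_comp.add
    ((h.hasDerivAt_right t).ofReal_comp.mul_const Complex.I)).congr_deriv ?_
    |>.congr_of_eventuallyEq (.of_forall fun s ↦ ?_)
  · simp only [solDeriv]; push_cast; ring
  · simp only [solDeriv, sol, Pi.add_apply]; push_cast; ring

lemma continuous_logDeriv (h : FundamentalPair S u v) (hε : 0 < ε) :
    Continuous fun s ↦ solDeriv u v ε s / sol u v ε s := by
  have h1 := h.contDiff_left.continuous_deriv le_rfl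
  have h2 := h.contDiff_right.continuous_deriv le_rfl
  have h3 := h.contDiff_left.continuous
  have h4 := h.contDiff_right.continuous
  refine Continuous.div₀ ?_ ?_ (h.sol_ne_zero hε)
  · unfold solDeriv; fun_prop
  · unfold sol; fun_prop

lemma hasDerivAt_logSol (h : FundamentalPair S u v) (hε : 0 < ε) (t : ℝ) :
    HasDerivAt (logSol u v ε T) (solDeriv u v ε t / sol u v ε t) t :=
  (intervalIntegral.integral_hasDerivAt_right ((h.continuous_logDeriv hε).intervalIntegrable _ _)
    ((h.continuous_logDeriv hε).stronglyMeasurableAtFilter _ _)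
    (h.continuous_logDeriv hε).continuousAt).const_add _

lemma exp_logSol (h : FundamentalPair S u v) (hε : 0 < ε) (hu : u T = 1) (hv : v T = 0) (t : ℝ) :
    Complex.exp (logSol u v ε T t) = sol u v ε t := by
  set f : ℝ → ℂ := fun s ↦ sol u v ε s * Complex.exp (-logSol u v ε T s) with hf
  have hd (s : ℝ) : HasDerivAt f 0 s := by
    refine (h.hasDerivAt_sol s).mul (h.hasDerivAt_logSol (T := T) hε s).neg.cexp |>.congr_deriv ?_
    have := h.sol_ne_zero hε s
    field_simp
    ring
  have h0 : f t = f T := is_const_of_deriv_eq_zero (fun s ↦ (hd s).differentiableAt)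
    (fun s ↦ (hd s).deriv) t T
  have h1 : f T = 1 := by
    have hε' : (ε : ℂ) ≠ 0 := by exact_mod_cast hε.ne'
    simp only [hf, logSol, sol, hu, hv, intervalIntegral.integral_same, add_zero, Complex.exp_neg]
    rw [← Complex.ofReal_exp, Real.exp_log hε]
    simp [hε']
  rw [h1, hf] at h0
  simp only [Complex.exp_neg] at h0
  exact (eq_of_div_eq_one h0).symm

lemma re_logSol (h : FundamentalPair S u v) (hε : 0 < ε) (hu : u T = 1) (hv : v T = 0) (t : ℝ) :
    (logSol u v ε T t).re = Real.log ‖sol u v ε t‖ := by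
  rw [← h.exp_logSol hε hu hv, Complex.norm_exp, Real.log_exp]

lemma hasDerivAt_width_sub (h : FundamentalPair S u v) (hε : 0 < ε) (t : ℝ) :
    HasDerivAt (fun s ↦ width u v ε s - Complex.I * (S s : ℂ))
      (-Complex.I * width u v ε t ^ 2) t := by
  have hne := h.sol_ne_zero hε
  have h1 : (fun s ↦ width u v ε s - Complex.I * (S s : ℂ)) =
      fun s ↦ -Complex.I * ((solDeriv u v ε s + S s * sol u v ε s) / sol u v ε s) := by
    ext s
    have := hne s
    simp only [width]
    field_simp
    ring
  rw [h1]
  refine (((h.hasDerivAt_quasiDeriv_sol t).div (h.hasDerivAt_sol t) (hne t)).const_mul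
    (-Complex.I)).congr_deriv ?_
  have := hne t
  simp only [width, mul_pow, neg_sq, Complex.I_sq]
  field_simp
  ring

lemma hasDerivAt_inv_sol (h : FundamentalPair S u v) (hε : 0 < ε) (t : ℝ) :
    HasDerivAt (fun s ↦ (sol u v ε s)⁻¹) (-Complex.I * width u v ε t * (sol u v ε t)⁻¹) t := by
  have := h.sol_ne_zero hε t
  refine ((h.hasDerivAt_sol t).fun_inv this).congr_deriv ?_
  simp only [width]
  field_simp
  simp [Complex.I_sq]

lemma hasDerivAt_logAmplitude (h : FundamentalPair S u v) (hε : 0 < ε) (x : Space n) (t : ℝ) :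
    HasDerivAt (logAmplitude x u v ε T)
      (Complex.I / 2 * ((sol u v ε t)⁻¹ ^ 2 * ‖x‖ ^ 2 - n * width u v ε t)) t := by
  have hne := h.sol_ne_zero hε t
  refine ((((h.hasDerivAt_left' t).ofReal_comp.div (h.hasDerivAt_sol t) hne).mul_const
    ((‖x‖ : ℂ) ^ 2 / 2)).neg.sub ((h.hasDerivAt_logSol (T := T) hε t).const_mul
    ((n : ℂ) / 2))).congr_deriv ?_
  -- the Wronskian of `u` and `w` is `i`
  have hw : ((deriv u t : ℝ) : ℂ) * sol u v ε t - u t * solDeriv u v ε t = -Complex.I := by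
    have := congrArg (fun r : ℝ ↦ (r : ℂ)) (h.wronskian t)
    simp only [sol, solDeriv]
    push_cast at this ⊢
    linear_combination -Complex.I * this
  rw [hw]
  simp only [width]
  field_simp
  linear_combination (-(n : ℂ) * solDeriv u v ε t * sol u v ε t) * Complex.I_sq

lemma re_width (h : FundamentalPair S u v) (t : ℝ) :
    (width u v ε t).re = ε / Complex.normSq (sol u v ε t) := by
  have : (width u v ε t).re = (solDeriv u v ε t / sol u v ε t).im := by simp [width]
  rw [this, Complex.div_im]
  simp only [solDeriv, sol, Complex.add_re, Complex.add_im, Complex.ofReal_re, Complex.ofReal_im,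
    Complex.mul_re, Complex.mul_im, Complex.I_re, Complex.I_im]
  rw [← sub_div]
  congr 1
  linear_combination ε * h.wronskian t

lemma re_width_pos (h : FundamentalPair S u v) (hε : 0 < ε) (t : ℝ) : 0 < (width u v ε t).re := by
  rw [h.re_width]
  exact div_pos hε (Complex.normSq_pos.2 (h.sol_ne_zero hε t))

/-- The evolving Gaussian is bounded by its amplitude `|w|^{-n/2}`. -/
lemma norm_gaussian_le (h : FundamentalPair S u v) (hε : 0 < ε) (hu : u T = 1) (hv : v T = 0)
    (x y : Space n) (t : ℝ) :
    ‖gaussian x (width u v ε t) (sol u v ε t)⁻¹ (logAmplitude x u v ε T t)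
      (h.re_width_pos hε t) y‖ ≤ ‖sol u v ε t‖ ^ (-(n : ℝ) / 2) := by
  have hN : 0 < Complex.normSq (sol u v ε t) := Complex.normSq_pos.2 (h.sol_ne_zero hε t)
  have hb : ((sol u v ε t)⁻¹).re = ε * u t / Complex.normSq (sol u v ε t) := by
    rw [Complex.inv_re]; simp [sol]
  have hc : (logAmplitude x u v ε T t).re =
      -(ε * u t ^ 2 / Complex.normSq (sol u v ε t) * (‖x‖ ^ 2 / 2))
        - n / 2 * Real.log ‖sol u v ε t‖ := by
    have h1 : (((u t : ℝ) : ℂ) / sol u v ε t * (‖x‖ ^ 2 / 2)) =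
        ((u t * (‖x‖ ^ 2 / 2) : ℝ) : ℂ) * (sol u v ε t)⁻¹ := by push_cast; ring
    have h2 : ((n : ℂ) / 2) = ((n / 2 : ℝ) : ℂ) := by push_cast; rfl
    rw [logAmplitude, h1, h2, Complex.sub_re, Complex.neg_re, Complex.re_ofReal_mul,
      Complex.re_ofReal_mul, h.re_logSol hε hu hv, hb]
    ring
  rw [gaussian_apply, Complex.norm_exp, re_quadPhase, hb, hc, h.re_width,
    Real.rpow_def_of_pos (norm_pos_iff.2 (h.sol_ne_zero hε t))]
  refine Real.exp_le_exp.2 ?_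
  have h3 : ‖y - u t • x‖ ^ 2 = ‖y‖ ^ 2 - 2 * u t * inner ℝ x y + u t ^ 2 * ‖x‖ ^ 2 := by
    rw [norm_sub_sq_real, inner_smul_right, norm_smul, mul_pow, Real.norm_eq_abs, sq_abs,
      real_inner_comm]
    ring
  have h4 : 0 ≤ ε / (2 * Complex.normSq (sol u v ε t)) * ‖y - u t • x‖ ^ 2 := by positivity
  rw [h3] at h4
  have h5 : ε / (2 * Complex.normSq (sol u v ε t)) *
      (‖y‖ ^ 2 - 2 * u t * inner ℝ x y + u t ^ 2 * ‖x‖ ^ 2) =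
      ε / Complex.normSq (sol u v ε t) / 2 * ‖y‖ ^ 2 -
        ε * u t / Complex.normSq (sol u v ε t) * inner ℝ x y
        + ε * u t ^ 2 / Complex.normSq (sol u v ε t) * (‖x‖ ^ 2 / 2) := by
    field_simp
  linarith

end FundamentalPair

section Evolution

variable {n : ℕ} {σ ζ₁ ζ₂ : ℝ → ℝ} {M : ℝ} {U : ℝ → ℝ → (L2 n ≃ₗᵢ[ℂ] L2 n)}

open FundamentalPair

/-- The adjoint of `U(T,0)` maps a real Gaussian of width `√ε` and mass independent of `ε` to a
Gaussian whose supremum is bounded independently of `ε`. -/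
theorem IsPropagator.exists_inner_gaussian_eq (hU : IsPropagator σ U)
    (h₁ : SolvesIVP σ ζ₁ 1 0) (h₂ : SolvesIVP σ ζ₂ 0 1)
    (hσ : ∀ᵐ s, |σ s| ≤ M) (hσi : ∀ a b, IntervalIntegrable σ volume a b)
    {T ε : ℝ} (hT : ζ₂ T ≠ 0) (hε : 0 < ε) (x : Space n) :
    ∃ g G : 𝓢(Space n, ℂ),
      (∀ y, g y = ((ε ^ (-(n : ℝ) / 2) * Real.exp (-(‖y - x‖ ^ 2 / (2 * ε))) : ℝ) : ℂ)) ∧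
      (∀ y, ‖G y‖ ≤ |ζ₂ T| ^ (-(n : ℝ) / 2)) ∧
      ∀ f : L2 n, inner ℂ (toL2 g) (U T 0 f) = inner ℂ (toL2 G) f := by
  set u : ℝ → ℝ := fun s ↦ deriv ζ₂ T * ζ₁ s - deriv ζ₁ T * ζ₂ s with hu
  set v : ℝ → ℝ := fun s ↦ ζ₁ T * ζ₂ s - ζ₂ T * ζ₁ s with hv
  have h : FundamentalPair (fun s ↦ ∫ r in 0..s, σ r) u v := fundamentalPair_at h₁ h₂ hσ hσi T
  have huT : u T = 1 := by
    rw [hu]; linear_combination wronskian_eq_one h₁ h₂ hσ hσi T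
  have hvT : v T = 0 := by rw [hv]; ring
  have hv0 : v 0 = -ζ₂ T := by simp [hv, h₁.init, h₂.init]
  set g : ℝ → 𝓢(Space n, ℂ) := fun s ↦ gaussian x (width u v ε s) (sol u v ε s)⁻¹
    (logAmplitude x u v ε T s) (h.re_width_pos hε s) with hg
  have hsolT : sol u v ε T = ε := by simp [sol, huT, hvT]
  refine ⟨g T, g 0, fun y ↦ ?_, fun y ↦ ?_, fun f ↦ ?_⟩
  · have hu' : deriv u T = 0 := by
      refine HasDerivAt.deriv ((((h₁.hasDerivAt T).const_mul (deriv ζ₂ T)).sub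
        ((h₂.hasDerivAt T).const_mul (deriv ζ₁ T))).congr_deriv ?_)
      ring
    have hv' : deriv v T = 1 := by
      have hw := h.wronskian T
      rw [huT, hvT] at hw
      linarith
    have hε' : (ε : ℂ) ≠ 0 := by exact_mod_cast hε.ne'
    have hwid : width u v ε T = (ε⁻¹ : ℝ) := by
      simp only [width, hsolT, solDeriv, hu', hv']
      push_cast
      field_simp
      simp
    have hamp : logAmplitude x u v ε T T =
        ((-(ε⁻¹ * (‖x‖ ^ 2 / 2)) - n / 2 * Real.log ε : ℝ) : ℂ) := by
      simp only [logAmplitude, logSol, intervalIntegral.integral_same, hsolT, huT]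
      push_cast
      field_simp
      simp
    have hphase : quadPhase x (width u v ε T) (sol u v ε T)⁻¹ (logAmplitude x u v ε T T) y =
        ((Real.log ε * (-(n : ℝ) / 2) + -(‖y - x‖ ^ 2 / (2 * ε)) : ℝ) : ℂ) := by
      rw [hwid, hsolT, hamp, quadPhase, norm_sub_sq_real, real_inner_comm]
      push_cast
      field_simp
      ring
    rw [hg, gaussian_apply, hphase, ← Complex.ofReal_exp, Real.exp_add,
      ← Real.rpow_def_of_pos hε]
  · refine (h.norm_gaussian_le hε huT hvT x y 0).trans ?_
    refine Real.rpow_le_rpow_of_nonpos (abs_pos.2 hT) ?_ ?_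
    · calc |ζ₂ T| = |(sol u v ε 0).im| := by simp [sol, hv0]
        _ ≤ _ := Complex.abs_im_le_norm _
    · have : (0 : ℝ) ≤ n := n.cast_nonneg
      linarith
  · have hS (φ : 𝓢(Space n, ℂ)) :
        inner ℂ (toL2 (g T)) (U T 0 (toL2 φ)) = inner ℂ (toL2 (g 0)) (toL2 φ) := by
      have hd (t : ℝ) := hU.hasDerivAt_inner_gaussian hσ hσi φ x (h.re_width_pos hε)
        (h.hasDerivAt_width_sub hε t) (h.hasDerivAt_inv_sol hε t)
        (h.hasDerivAt_logAmplitude (T := T) hε x t)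
      have := is_const_of_deriv_eq_zero (fun s ↦ (hd s).differentiableAt)
        (fun s ↦ (hd s).deriv) T 0
      simpa only [hU.refl] using this
    have hdense : DenseRange (toL2 : 𝓢(Space n, ℂ) → L2 n) :=
      SchwartzMap.denseRange_toLpCLM (F := ℂ) (p := 2) (μ := (volume : Measure (Space n)))
        (by simp)
    refine congrFun (DenseRange.equalizer (g := fun f : L2 n ↦ inner ℂ (toL2 (g T)) (U T 0 f))
      (h := fun f : L2 n ↦ inner ℂ (toL2 (g 0)) f) hdense ?_ ?_ (funext hS)) f
    · exact continuous_const.inner (U T 0).continuous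
    · exact continuous_const.inner continuous_id

lemma exists_ae_abs_le_of_memLp_top (h : MemLp σ ∞ volume) :
    ∃ M, ∀ᵐ s, |σ s| ≤ M := by
  refine ⟨(eLpNormEssSup σ volume).toReal, ?_⟩
  filter_upwards [ae_le_eLpNormEssSup (f := σ) (μ := volume)] with s hs
  have h1 : eLpNormEssSup σ volume ≠ ∞ := by simpa using h.eLpNorm_ne_top
  rw [← Real.norm_eq_abs, ← toReal_enorm]
  exact ENNReal.toReal_mono h1 hs

lemma intervalIntegrable_of_memLp_top (h : MemLp σ ∞ volume) (a b : ℝ) :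
    IntervalIntegrable σ volume a b :=
  ((h.locallyIntegrable le_top).integrableOn_isCompact isCompact_uIcc).intervalIntegrable

end Evolution

/-! ### Gaussian means of square integrable functions -/

section GaussianMeans

variable {n : ℕ} {u : Space n → ℂ} {B : ℝ}

/-- The standard Gaussian weight. -/
def weight (z : Space n) : ℝ := Real.exp (-(‖z‖ ^ 2 / 2))

lemma weight_pos (z : Space n) : 0 < weight z := Real.exp_pos _

lemma continuous_weight : Continuous (weight : Space n → ℝ) := by
  unfold weight; fun_prop

lemma integrable_weight : Integrable (weight : Space n → ℝ) := by
  have h := (gaussian (0 : Space n) 1 0 0 (by simp)).integrable (μ := volume)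
  refine h.norm.congr (.of_forall fun z ↦ ?_)
  simp only [gaussian_apply, Complex.norm_exp, re_quadPhase, weight]
  congr 1
  simp
  ring

lemma integral_weight_pos : 0 < ∫ z : Space n, weight z := by
  rw [integral_pos_iff_support_of_nonneg (fun z ↦ (weight_pos z).le) integrable_weight]
  have : Function.support (weight : Space n → ℝ) = Set.univ :=
    Set.eq_univ_of_forall fun z ↦ (weight_pos z).ne'
  rw [this]
  exact Measure.measure_univ_pos.2 (NeZero.ne _)

/-- Gaussian means of a bounded continuous function over shrinking scales. -/
lemma tendsto_integral_weight_smul {h : Space n → ℂ} (hc : Continuous h) {D : ℝ}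
    (hD : ∀ y, ‖h y‖ ≤ D) (x : Space n) :
    Tendsto (fun r : ℝ ↦ ∫ z, weight z • h (x + r • z)) (𝓝[>] 0)
      (𝓝 ((∫ z : Space n, weight z) • h x)) := by
  rw [← integral_smul_const]
  refine tendsto_integral_filter_of_dominated_convergence (fun z ↦ weight z * D) ?_ ?_
    (integrable_weight.mul_const D) ?_
  · refine .of_forall fun r ↦ Continuous.aestronglyMeasurable ?_
    exact continuous_weight.smul (hc.comp (by fun_prop))
  · refine .of_forall fun r ↦ .of_forall fun z ↦ ?_
    rw [norm_smul, Real.norm_of_nonneg (weight_pos z).le]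
    exact mul_le_mul_of_nonneg_left (hD _) (weight_pos z).le
  · refine .of_forall fun z ↦ Tendsto.const_smul ?_ _
    have h1 : Continuous fun r : ℝ ↦ h (x + r • z) := hc.comp (by fun_prop)
    have h2 := h1.tendsto 0
    rw [zero_smul, add_zero] at h2
    exact h2.mono_left nhdsWithin_le_nhds

section Translates

variable {b : Space n → ℝ}

lemma norm_smul_le_sq_add_sq {s : ℝ} (hs : 0 ≤ s) (w : ℂ) : ‖s • w‖ ≤ s ^ 2 + ‖w‖ ^ 2 := by
  rw [norm_smul, Real.norm_of_nonneg hs]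
  nlinarith [sq_nonneg (s - ‖w‖), sq_nonneg s, sq_nonneg ‖w‖]

lemma integrable_sq_of_continuous (hb : Continuous b) (hbs : HasCompactSupport b) :
    Integrable fun t ↦ b t ^ 2 := by
  have h : HasCompactSupport ((fun s : ℝ ↦ s ^ 2) ∘ b) := hbs.comp_left (by simp)
  exact Continuous.integrable_of_hasCompactSupport (by fun_prop) h

lemma integrable_norm_sq_translate (hu2 : MemLp u 2) (y : Space n) :
    Integrable fun t ↦ ‖u (y - t)‖ ^ 2 := by
  have h : Integrable fun y ↦ ‖u y‖ ^ 2 := (memLp_two_iff_integrable_sq_norm hu2.1).1 hu2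
  exact h.comp_sub_left y

lemma integrable_sq_add_sq (hu2 : MemLp u 2) (hb : Continuous b) (hbs : HasCompactSupport b)
    (y : Space n) : Integrable fun t ↦ b t ^ 2 + ‖u (y - t)‖ ^ 2 :=
  (integrable_sq_of_continuous hb hbs).add (integrable_norm_sq_translate hu2 y)

lemma integrable_smul_translate (hu : StronglyMeasurable u) (hu2 : MemLp u 2) (hb : Continuous b)
    (hbs : HasCompactSupport b) (hb0 : ∀ t, 0 ≤ b t) (y : Space n) :
    Integrable fun t ↦ b t • u (y - t) := by
  refine (integrable_sq_add_sq hu2 hb hbs y).mono' ?_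
    (.of_forall fun t ↦ norm_smul_le_sq_add_sq (hb0 t) _)
  have h1 : StronglyMeasurable fun t ↦ u (y - t) :=
    hu.comp_measurable (measurable_const.sub measurable_id)
  exact hb.aestronglyMeasurable.smul h1.aestronglyMeasurable

lemma exists_integral_norm_smul_translate_le (hu : StronglyMeasurable u) (hu2 : MemLp u 2)
    (hb : Continuous b) (hbs : HasCompactSupport b) (hb0 : ∀ t, 0 ≤ b t) :
    ∃ D, ∀ y : Space n, ∫ t, ‖b t • u (y - t)‖ ≤ D := by
  refine ⟨∫ t, (b t ^ 2 + ‖u (0 - t)‖ ^ 2), fun y ↦ ?_⟩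
  have hb2 := integrable_sq_of_continuous hb hbs
  refine (integral_mono (integrable_smul_translate hu hu2 hb hbs hb0 y).norm
    (integrable_sq_add_sq hu2 hb hbs y) fun t ↦ norm_smul_le_sq_add_sq (hb0 t) _).trans_eq ?_
  rw [integral_add hb2 (integrable_norm_sq_translate hu2 y),
    integral_add hb2 (integrable_norm_sq_translate hu2 0),
    integral_sub_left_eq_self (fun y ↦ ‖u y‖ ^ 2) volume y,
    integral_sub_left_eq_self (fun y ↦ ‖u y‖ ^ 2) volume 0]

end Translates

/-- If all Gaussian means of `u ∈ L²` are bounded by `B`, so are those of any average of translates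
of `u`. -/
lemma norm_integral_weight_smul_integral_le (hu : StronglyMeasurable u) (hu2 : MemLp u 2)
    (hB : ∀ x : Space n, ∀ r : ℝ, 0 < r → ‖∫ z, weight z • u (x + r • z)‖ ≤ B)
    {b : Space n → ℝ} (hb : Continuous b) (hbs : HasCompactSupport b) (hb0 : ∀ t, 0 ≤ b t)
    (hb1 : ∫ t, b t = 1) (x : Space n) {r : ℝ} (hr : 0 < r) :
    ‖∫ z, weight z • ∫ t, b t • u (x + r • z - t)‖ ≤ B := by
  have hbi : Integrable b := hb.integrable_of_hasCompactSupport hbs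
  have hint := integrable_smul_translate hu hu2 hb hbs hb0
  obtain ⟨D, hintD⟩ := exists_integral_norm_smul_translate_le hu hu2 hb hbs hb0
  set F : Space n → Space n → ℂ := fun z t ↦ weight z • b t • u (x + r • z - t) with hF
  have hFm : StronglyMeasurable (Function.uncurry F) := by
    have h1 : StronglyMeasurable fun p : Space n × Space n ↦ weight p.1 :=
      (continuous_weight.comp continuous_fst).stronglyMeasurable
    have h2 : StronglyMeasurable fun p : Space n × Space n ↦ b p.2 :=
      (hb.comp continuous_snd).stronglyMeasurable
    have h3 : StronglyMeasurable fun p : Space n × Space n ↦ u (x + r • p.1 - p.2) :=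
      hu.comp_measurable (Continuous.measurable (by fun_prop))
    exact h1.smul (h2.smul h3)
  have hnorm (z t : Space n) : ‖F z t‖ = weight z * ‖b t • u (x + r • z - t)‖ := by
    rw [hF]; simp only []; rw [norm_smul, Real.norm_of_nonneg (weight_pos z).le]
  have hFi : Integrable (Function.uncurry F) (volume.prod volume) := by
    rw [integrable_prod_iff hFm.aestronglyMeasurable]
    refine ⟨.of_forall fun z ↦ (hint (x + r • z)).smul (weight z), ?_⟩
    refine (integrable_weight.mul_const D).mono'
      hFm.norm.integral_prod_right.aestronglyMeasurable (.of_forall fun z ↦ ?_)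
    rw [Real.norm_of_nonneg (integral_nonneg fun t ↦ norm_nonneg _)]
    simp only [Function.uncurry_apply_pair, hnorm]
    rw [integral_const_mul]
    exact mul_le_mul_of_nonneg_left (hintD _) (weight_pos z).le
  have hswap : ∫ z, weight z • ∫ t, b t • u (x + r • z - t) =
      ∫ t, b t • ∫ z, weight z • u (x - t + r • z) := by
    calc _ = ∫ z, ∫ t, F z t := by simp_rw [hF, integral_smul]
      _ = ∫ t, ∫ z, F z t := integral_integral_swap hFi
      _ = _ := by
        congr 1
        ext t
        rw [← integral_smul]
        congr 1
        ext z
        rw [hF]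
        simp only []
        rw [smul_comm]
        congr 3
        abel
  rw [hswap]
  calc _ ≤ ∫ t, b t * B := by
        refine norm_integral_le_of_norm_le (hbi.mul_const B) (.of_forall fun t ↦ ?_)
        rw [norm_smul, Real.norm_of_nonneg (hb0 t)]
        exact mul_le_mul_of_nonneg_left (hB _ _ hr) (hb0 t)
    _ = B := by rw [integral_mul_const, hb1, one_mul]

/-- A function in `L²` is bounded by its Gaussian means, up to the total mass of the weight. -/
theorem ae_norm_le_of_norm_integral_weight_le (hu : StronglyMeasurable u) (hu2 : MemLp u 2)
    (hB : ∀ x : Space n, ∀ r : ℝ, 0 < r → ‖∫ z, weight z • u (x + r • z)‖ ≤ B) :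
    ∀ᵐ x, (∫ z : Space n, weight z) * ‖u x‖ ≤ B := by
  have hloc : LocallyIntegrable u := hu2.locallyIntegrable (by norm_num)
  set b : ℕ → ContDiffBump (0 : Space n) := fun k ↦
    ⟨1 / (k + 1), 2 / (k + 1), by positivity, by gcongr; norm_num⟩ with hb
  have hb0 : Tendsto (fun k ↦ (b k).rOut) atTop (𝓝 0) := by
    have := (tendsto_one_div_add_atTop_nhds_zero_nat (𝕜 := ℝ)).const_mul 2
    simpa [hb, div_eq_mul_inv] using this
  have hlim := ContDiffBump.ae_convolution_tendsto_right_of_locallyIntegrable (μ := volume)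
    (φ := b) (K := 2) hb0 (.of_forall fun k ↦ by simp [hb, div_eq_mul_inv]) hloc
  filter_upwards [hlim] with x hx
  refine le_of_tendsto (hx.norm.const_mul _) (.of_forall fun k ↦ ?_)
  set f := (b k).normed volume with hf
  have hfc : Continuous f := (b k).continuous_normed
  have hfs : HasCompactSupport f := (b k).hasCompactSupport_normed
  set h : Space n → ℂ := convolution f u (ContinuousLinearMap.lsmul ℝ ℝ) volume with hh
  have hhc : Continuous h :=
    hfs.continuous_convolution_left (ContinuousLinearMap.lsmul ℝ ℝ) hfc hloc
  have happly (y : Space n) : h y = ∫ t, f t • u (y - t) := rfl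
  have hf0 : ∀ t, 0 ≤ f t := (b k).nonneg_normed
  have hf1 : ∫ t, f t = 1 := (b k).integral_normed
  obtain ⟨D, hD⟩ := exists_integral_norm_smul_translate_le hu hu2 hfc hfs hf0
  have hhD (y : Space n) : ‖h y‖ ≤ D := (norm_integral_le_integral_norm _).trans (hD y)
  have hm : ‖(∫ z : Space n, weight z) • h x‖ ≤ B := by
    refine le_of_tendsto (tendsto_integral_weight_smul hhc hhD x).norm ?_
    filter_upwards [self_mem_nhdsWithin] with r hr
    exact norm_integral_weight_smul_integral_le hu hu2 hB hfc hfs hf0 hf1 x hr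
  rwa [norm_smul, Real.norm_of_nonneg integral_weight_pos.le] at hm

end GaussianMeans

/-! ### Extension to integrable data and the decay rate -/

section Extension

variable {n : ℕ}

/-- The pairs of an element of `L¹` and an element of `L²` that are given by the same function. This
encodes `L¹ ∩ L²` with both of its maps into `L¹` and `L²`. -/
def interL1L2 (n : ℕ) :
    Submodule ℂ (Lp ℂ 1 (volume : Measure (Space n)) × L2 n) where
  carrier := {p | (p.1 : Space n → ℂ) =ᵐ[volume] (p.2 : Space n → ℂ)}
  zero_mem' := (Lp.coeFn_zero ℂ 1 _).trans (Lp.coeFn_zero ℂ 2 _).symm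
  add_mem' {p q} hp hq := by
    change _ =ᵐ[_] _ at hp hq
    exact (Lp.coeFn_add p.1 q.1).trans ((hp.add hq).trans (Lp.coeFn_add p.2 q.2).symm)
  smul_mem' c p hp := by
    change _ =ᵐ[_] _ at hp
    exact (Lp.coeFn_smul c p.1).trans ((hp.const_smul c).trans (Lp.coeFn_smul c p.2).symm)

lemma denseRange_fst_interL1L2 :
    DenseRange ((LinearMap.fst ℂ _ _).comp (interL1L2 n).subtype) := by
  have hd : DenseRange fun ψ : 𝓢(Space n, ℂ) ↦ ψ.toLp 1 (volume : Measure (Space n)) :=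
    SchwartzMap.denseRange_toLpCLM (F := ℂ) (p := 1) (μ := (volume : Measure (Space n))) (by simp)
  refine hd.mono ?_
  rintro _ ⟨ψ, rfl⟩
  exact ⟨⟨(ψ.toLp 1 volume, toL2 ψ), (ψ.coeFn_toLp 1 volume).trans (coeFn_toL2 ψ).symm⟩, rfl⟩

lemma norm_toLp_top_le {f : Space n → ℂ} {C : ℝ} (hf : MemLp f ∞ volume) (hC : 0 ≤ C)
    (h : ∀ᵐ x, ‖f x‖ ≤ C) : ‖hf.toLp f‖ ≤ C := by
  rw [Lp.norm_toLp, eLpNorm_exponent_top]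
  exact ENNReal.toReal_le_of_le_ofReal hC (eLpNormEssSup_le_of_ae_bound h)

/-- An operator on `L²` that satisfies an `L¹ → L^∞` bound on `L¹ ∩ L²` extends to `L¹`. -/
theorem exists_extendsToL1 (V : L2 n ≃ₗᵢ[ℂ] L2 n) {K : ℝ} (hK : 0 ≤ K)
    (h : ∀ (f : Lp ℂ 1 (volume : Measure (Space n))) (g : L2 n),
      (f : Space n → ℂ) =ᵐ[volume] (g : Space n → ℂ) → ∀ᵐ x, ‖V g x‖ ≤ K * ‖f‖) :
    ∃ T : Lp ℂ 1 (volume : Measure (Space n)) →L[ℂ] Lp ℂ ∞ (volume : Measure (Space n)),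
      ExtendsToL1 V T ∧ ∀ φ, ‖T φ‖ ≤ K * ‖φ‖ := by
  have hm (p : interL1L2 n) : MemLp (V p.1.2 : Space n → ℂ) ∞ volume :=
    memLp_top_of_bound (Lp.aestronglyMeasurable _) _ (h _ _ p.2)
  let F : interL1L2 n →ₗ[ℂ] Lp ℂ ∞ (volume : Measure (Space n)) :=
    { toFun := fun p ↦ (hm p).toLp _
      map_add' := fun p q ↦ by
        refine Lp.ext ?_
        filter_upwards [(hm (p + q)).coeFn_toLp, (hm p).coeFn_toLp, (hm q).coeFn_toLp,
          Lp.coeFn_add ((hm p).toLp _) ((hm q).toLp _),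
          Lp.coeFn_add (V p.1.2) (V q.1.2)] with x h1 h2 h3 h4 h5
        rw [h1, h4, Pi.add_apply, h2, h3, ← Pi.add_apply, ← h5, ← map_add]
        rfl
      map_smul' := fun c p ↦ by
        refine Lp.ext ?_
        filter_upwards [(hm (c • p)).coeFn_toLp, (hm p).coeFn_toLp,
          Lp.coeFn_smul c ((hm p).toLp _), Lp.coeFn_smul c (V p.1.2)] with x h1 h2 h3 h4
        rw [h1, RingHom.id_apply, h3, Pi.smul_apply, h2, ← Pi.smul_apply, ← h4, ← map_smul]
        rfl }
  set e := (LinearMap.fst ℂ _ _).comp (interL1L2 n).subtype with he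
  have hF (p : interL1L2 n) : ‖F p‖ ≤ K * ‖e p‖ :=
    norm_toLp_top_le (hm p) (by positivity) (h _ _ p.2)
  refine ⟨F.extendOfNorm e, fun f g hfg ↦ ?_,
    LinearMap.norm_extendOfNorm_apply_le denseRange_fst_interL1L2 K hF⟩
  have := LinearMap.extendOfNorm_eq (f := F) denseRange_fst_interL1L2 ⟨K, hF⟩ ⟨(f, g), hfg⟩
  rw [show f = e ⟨(f, g), hfg⟩ from rfl, this]
  exact (hm ⟨(f, g), hfg⟩).coeFn_toLp

end Extension

section Dispersive

variable {n : ℕ} {σ ζ₁ ζ₂ : ℝ → ℝ} {r₀ M : ℝ} {U : ℝ → ℝ → (L2 n ≃ₗᵢ[ℂ] L2 n)}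

/-- Rescaling a Gaussian mean to unit scale. -/
lemma integral_weight_smul_eq (u : Space n → ℂ) (x : Space n) {r : ℝ} (hr : 0 < r) :
    ∫ z, weight z • u (x + r • z) =
      ∫ y, ((r ^ 2) ^ (-(n : ℝ) / 2) * Real.exp (-(‖y - x‖ ^ 2 / (2 * r ^ 2)))) • u y := by
  set f : Space n → ℂ := fun w ↦ Real.exp (-(‖w‖ ^ 2 / (2 * r ^ 2))) • u (x + w) with hf
  have h1 (z : Space n) : weight z • u (x + r • z) = f (r • z) := by
    simp only [hf, weight, norm_smul, mul_pow, Real.norm_eq_abs, sq_abs]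
    congr 3
    field_simp
  have h2 : (r ^ 2) ^ (-(n : ℝ) / 2) = (r ^ n)⁻¹ := by
    rw [← Real.rpow_natCast r 2, ← Real.rpow_mul hr.le, ← Real.rpow_natCast r n,
      ← Real.rpow_neg hr.le]
    congr 1
    push_cast
    ring
  simp_rw [h1]
  rw [Measure.integral_comp_smul_of_nonneg volume f r (hR := hr.le), finrank_euclideanSpace_fin,
    ← h2, ← integral_smul, ← integral_add_left_eq_self (fun y ↦ ((r ^ 2) ^ (-(n : ℝ) / 2) *
      Real.exp (-(‖y - x‖ ^ 2 / (2 * r ^ 2)))) • u y) x]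
  simp only [hf, mul_smul, add_sub_cancel_left]

/-- The dispersive estimate on `L¹ ∩ L²`. -/
theorem IsPropagator.ae_norm_apply_le (hU : IsPropagator σ U)
    (h₁ : SolvesIVP σ ζ₁ 1 0) (h₂ : SolvesIVP σ ζ₂ 0 1)
    (hσ : ∀ᵐ s, |σ s| ≤ M) (hσi : ∀ a b, IntervalIntegrable σ volume a b)
    {t : ℝ} (ht : ζ₂ t ≠ 0) (f : Lp ℂ 1 (volume : Measure (Space n))) (g : L2 n)
    (hfg : (f : Space n → ℂ) =ᵐ[volume] (g : Space n → ℂ)) :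
    ∀ᵐ x, ‖U t 0 g x‖ ≤ |ζ₂ t| ^ (-(n : ℝ) / 2) / (∫ z : Space n, weight z) * ‖f‖ := by
  have hB (x : Space n) (r : ℝ) (hr : 0 < r) :
      ‖∫ z, weight z • (U t 0 g : Space n → ℂ) (x + r • z)‖
        ≤ |ζ₂ t| ^ (-(n : ℝ) / 2) * ‖f‖ := by
    obtain ⟨γ, G, hγ, hG, hin⟩ :=
      hU.exists_inner_gaussian_eq h₁ h₂ hσ hσi ht (pow_pos hr 2) x
    have e1 : ∫ z, weight z • (U t 0 g : Space n → ℂ) (x + r • z) =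
        inner ℂ (toL2 γ) (U t 0 g) := by
      rw [integral_weight_smul_eq _ _ hr, L2.inner_def]
      refine integral_congr_ae ?_
      filter_upwards [coeFn_toL2 γ] with y hy
      rw [hy, hγ, RCLike.inner_apply, Complex.conj_ofReal, Complex.real_smul, mul_comm]
    rw [e1, hin, L2.inner_def]
    have e2 : ∫ y, ‖(f : Space n → ℂ) y‖ = ‖f‖ := (L1.norm_eq_integral_norm f).symm
    rw [← e2, ← integral_const_mul]
    refine norm_integral_le_of_norm_le ((L1.integrable_coeFn f).norm.const_mul _) ?_
    filter_upwards [coeFn_toL2 G, hfg] with y hy hy'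
    rw [hy, hy']
    refine (norm_inner_le_norm _ _).trans ?_
    exact mul_le_mul_of_nonneg_right (hG y) (norm_nonneg _)
  filter_upwards [ae_norm_le_of_norm_integral_weight_le (Lp.stronglyMeasurable _)
    (Lp.memLp (U t 0 g)) hB] with x hx
  rw [div_mul_eq_mul_div, le_div_iff₀' integral_weight_pos]
  exact hx

lemma exists_eventually_le_abs {l : Filter ℝ} {f g : ℝ → ℝ} {c : ℝ} (hc : c ≠ 0)
    (h : Tendsto (fun t ↦ f t / g t) l (𝓝 c)) :
    ∀ᶠ t in l, |c| / 2 * |g t| ≤ |f t| := by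
  have h1 : |c| / 2 < |c| := half_lt_self (abs_pos.2 hc)
  filter_upwards [h.abs.eventually_const_le h1] with t ht
  rcases eq_or_ne (g t) 0 with h0 | h0
  · simp [h0]
  · rwa [abs_div, le_div_iff₀ (abs_pos.2 h0)] at ht

/-- The growth of `ζ₂`, uniformly on `|t| > r₀`. -/
lemma CriticalAssumption.exists_lower_bound (hA : CriticalAssumption σ ζ₁ ζ₂ r₀) :
    ∃ κ : ℝ, 0 < κ ∧ ∀ t : ℝ, r₀ < |t| → κ * (|t| ^ (1 / 2 : ℝ) * Real.log |t|) ≤ |ζ₂ t| := by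
  obtain ⟨c, hc, hlow⟩ := hA.lower
  obtain ⟨c₁, hc₁, h₁⟩ := hA.lim₂_top
  obtain ⟨c₂, hc₂, h₂⟩ := hA.lim₂_bot
  obtain ⟨R₁, hR₁⟩ := eventually_atTop.1 (exists_eventually_le_abs hc₁ h₁)
  obtain ⟨R₂, hR₂⟩ := eventually_atBot.1 (exists_eventually_le_abs hc₂ h₂)
  set R := max r₀ (max R₁ (-R₂)) with hR
  have hr := hA.one_lt
  have hR1 : 1 < R := hr.trans_le (le_max_left _ _)
  have hD : 0 < R ^ (1 / 2 : ℝ) * Real.log R := by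
    have := Real.log_pos hR1
    positivity
  refine ⟨min (c / (R ^ (1 / 2 : ℝ) * Real.log R)) (min (|c₁| / 2) (|c₂| / 2)), ?_, fun t ht ↦ ?_⟩
  · have := abs_pos.2 hc₁
    have := abs_pos.2 hc₂
    positivity
  have hg : 0 ≤ |t| ^ (1 / 2 : ℝ) * Real.log |t| := by
    have := Real.log_nonneg (hr.trans ht).le
    positivity
  rcases le_or_gt |t| R with htR | htR
  · -- on the bounded part only the lower bound `c` is available
    calc _ ≤ c / (R ^ (1 / 2 : ℝ) * Real.log R) * (R ^ (1 / 2 : ℝ) * Real.log R) := by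
          gcongr
          · exact min_le_left _ _
          · exact Real.log_nonneg (hr.trans ht).le
          · linarith
      _ = c := div_mul_cancel₀ c hD.ne'
      _ ≤ _ := hlow t ht
  · rcases le_total 0 t with h0 | h0
    · rw [abs_of_nonneg h0] at htR
      have h3 := hR₁ t (by simp [hR] at htR; linarith)
      rw [abs_of_nonneg hg] at h3
      refine le_trans ?_ h3
      gcongr
      exact (min_le_right _ _).trans (min_le_left _ _)
    · rw [abs_of_nonpos h0] at htR
      have h3 := hR₂ t (by simp [hR] at htR; linarith)
      rw [abs_of_nonneg hg] at h3
      refine le_trans ?_ h3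
      gcongr
      exact (min_le_right _ _).trans (min_le_right _ _)

end Dispersive

end CriticalHarmonic

end

theorem mainTheorem7 (n : ℕ) (hn : n = 1 ∨ n = 2 ∨ n = 3) (σ ζ₁ ζ₂ : ℝ → ℝ) (r₀ : ℝ)
    (hA : CriticalHarmonic.CriticalAssumption σ ζ₁ ζ₂ r₀) :
    ∃ C : ℝ, 0 < C ∧
      ∀ U : ℝ → ℝ → (CriticalHarmonic.L2 n ≃ₗᵢ[ℂ] CriticalHarmonic.L2 n),
        CriticalHarmonic.IsPropagator σ U →
        ∀ t : ℝ, r₀ < |t| →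
          ∃ T : Lp ℂ 1 (volume : Measure (CriticalHarmonic.Space n)) →L[ℂ]
              Lp ℂ ∞ (volume : Measure (CriticalHarmonic.Space n)),
            CriticalHarmonic.ExtendsToL1 (U t 0) T ∧
            ∀ φ : Lp ℂ 1 (volume : Measure (CriticalHarmonic.Space n)),
              ‖T φ‖ ≤ C * |t| ^ (-(n : ℝ) / 4) * (Real.log |t|) ^ (-(n : ℝ) / 2) * ‖φ‖ := by
  obtain ⟨κ, hκ, hlow⟩ := hA.exists_lower_bound
  obtain ⟨M, hM⟩ := CriticalHarmonic.exists_ae_abs_le_of_memLp_top hA.memLp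
  have hσi := CriticalHarmonic.intervalIntegrable_of_memLp_top hA.memLp
  have hw := CriticalHarmonic.integral_weight_pos (n := n)
  refine ⟨κ ^ (-(n : ℝ) / 2) / ∫ z : CriticalHarmonic.Space n, CriticalHarmonic.weight z,
    by positivity, fun U hU t ht ↦ ?_⟩
  have ht1 : 1 < |t| := hA.one_lt.trans ht
  have hlog : 0 < Real.log |t| := Real.log_pos ht1
  have hz : ζ₂ t ≠ 0 := by
    have := hlow t ht
    have h0 : 0 < κ * (|t| ^ (1 / 2 : ℝ) * Real.log |t|) := by positivity
    exact abs_pos.1 (h0.trans_le this)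
  obtain ⟨T, hT, hTn⟩ := CriticalHarmonic.exists_extendsToL1 (U t 0) (by positivity)
    (hU.ae_norm_apply_le hA.fund₁ hA.fund₂ hM hσi hz)
  refine ⟨T, hT, fun φ ↦ (hTn φ).trans ?_⟩
  gcongr
  have hpow : |ζ₂ t| ^ (-(n : ℝ) / 2) ≤
      κ ^ (-(n : ℝ) / 2) * (|t| ^ (-(n : ℝ) / 4) * Real.log |t| ^ (-(n : ℝ) / 2)) := by
    have hn0 : (0 : ℝ) ≤ n := n.cast_nonneg
    refine (Real.rpow_le_rpow_of_nonpos (by positivity) (hlow t ht) (by linarith)).trans_eq ?_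
    rw [Real.mul_rpow hκ.le (by positivity), Real.mul_rpow (by positivity) hlog.le,
      ← Real.rpow_mul (by positivity)]
    congr 3
    ring
  rw [div_mul_eq_mul_div, div_mul_eq_mul_div, mul_assoc]
  gcongr
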